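/- Let $d\in\mathbb N$, $\tau>0$, $p\in(0,1]$. For $k\ge 0$ and parameters $\theta=(\beta_0,(\beta_j,a_{j0},a_{j1},\dots,a_{jd})_{1\le j\le k})$ let $$g_\theta(z)=\beta_0+\sum_{j=1}^{k}\frac{\beta_j}{1+\exp\big(-a_{j0}-\sum_{h=1}^{d}a_{jh}z_h\big)},\qquad z\in[0,1]^{d},$$ and let $f_\theta(z,y)=\frac1{\sqrt{2\pi}}e^{-(y-g_\theta(z))^2/2}$ on $[0,1]^d\times\mathbb R$ be the joint density of $(Z,Y)$ when $Z$ is uniform on $[0,1]^d$ and $Y\mid Z=z\sim\mathcal N(g_\theta(z),1)$. Let $\Pi_i$ be the prior on the parameters of a network with $i$ hidden nodes under which all parameters are independent $\mathcal N(0,\tau^2)$, let $k$ have the geometric prior $\lambda_i=P(k=i)=p(1-p)^i$, $i=0,1,2,\dots$, and let $\Pi=\sum_i\lambda_i\Pi_i$ be the joint prior. Let $(Z_1,Y_1),(Z_2,Y_2),\dots$ be i.i.d. with a density $f_0$ on $[0,1]^d\times\mathbb R$ under which the inputs $Z_i$ are uniformly distributed on $[0,1]^d$. For a set $A$ of networks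 let $$P\big(A\mid (Z_1,Y_1),\dots,(Z_n,Y_n)\big)=\frac{\int_A\prod_{i=1}^n f_\theta(Z_i,Y_i)\,d\Pi(\theta)}{\int\prod_{i=1}^n f_\theta(Z_i,Y_i)\,d\Pi(\theta)}$$ be the posterior probability. Let $$H_\epsilon=\Big\{f:\Big(\iint\big(\sqrt{f(z,y)}-\sqrt{f_0(z,y)}\big)^2dz\,dy\Big)^{1/2}\le\epsilon\Big\},\qquad K_\gamma=\Big\{f: E_{f_0}\Big[\log\frac{f_0(z,y)}{f(z,y)}\Big]\le\gamma\Big\}.$$ Let $0<a<b<1$, let $(C_n)$ be a nondecreasing real sequence with $C_n\le\exp(n^{b-a})$, and let $\mathscr F_n$ be the set of all networks with $k\le n^a$ hidden nodes whose parameters satisfy $|a_{jh}|\le C_n$ and $|\beta_j|\le C_n$ for $1\le j\le k$, $1\le h\le d$. Let $(B_n)$ be a nondecreasing sequence of natural numbers. Assume: (A1) $\lambda_i>0$ for all $i$; (A2) for all $r>0$ there exist $q>1$ and $N$ such that $\sum_{i=B_n+1}^\infty\lambda_i<\exp(-n^q r)$ for all $n\ge N$; (A3) for every $i$ there exist $r_i>0$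 and $N_i$ such that $\Pi_i(\mathscr F_n^c)<\exp(-nr_i)$ for all $n\ge N_i$; (A4) for all $\gamma,v>0$ there exists $I$ such that for every $i\ge I$ there is $M_i$ with $\Pi_i(K_\gamma)\ge\exp(-nv)$ for all $n\ge M_i$. Then for every $\epsilon>0$ the posterior is asymptotically consistent for $f_0$ over Hellinger neighbourhoods: $P\big(H_\epsilon\mid(Z_1,Y_1),\dots,(Z_n,Y_n)\big)\to1$ in probability as $n\to\infty$. -/

import Mathlib

open MeasureTheory ProbabilityTheory Filter Set
open scoped ENNReal NNReal Topology

noncomputable section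

namespace BNN

/-- Parameters of a network with `d` inputs and `k` hidden nodes: `θ.1` is the intercept `β₀`, and
for each hidden node `j` the triple `θ.2 j = (β_j, a_{j0}, (a_{j1}, …, a_{jd}))` holds its output
weight, its bias and its input weights. -/
abbrev Params (d k : ℕ) : Type := ℝ × (Fin k → ℝ × ℝ × (Fin d → ℝ))

/-- The regression function `β₀ + ∑ⱼ βⱼ σ(a_{j0} + ∑ₕ a_{jh} z_h)`, with
`σ(t) = 1 / (1 + exp (-t))` the logistic function. -/
def net {d k : ℕ} (θ : Params d k) (z : Fin d → ℝ) : ℝ :=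
  θ.1 + ∑ j : Fin k, (θ.2 j).1 * Real.sigmoid ((θ.2 j).2.1 + ∑ h : Fin d, (θ.2 j).2.2 h * z h)

/-- The uniform distribution on the cube `[0,1]^d` (Lebesgue measure restricted to it). -/
def cubeUniform (d : ℕ) : Measure (Fin d → ℝ) := volume.restrict (Icc 0 1)

/-- Lebesgue measure on `[0,1]^d × ℝ`, with respect to which joint densities are taken. -/
def refMeasure (d : ℕ) : Measure ((Fin d → ℝ) × ℝ) := (cubeUniform d).prod volume

/-- The law on `[0,1]^d × ℝ` with density `f`. -/
def law {d : ℕ} (f : (Fin d → ℝ) × ℝ → ℝ) : Measure ((Fin d → ℝ) × ℝ) :=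
  (refMeasure d).withDensity fun x => ENNReal.ofReal (f x)

/-- The joint density on `[0,1]^d × ℝ` of `(Z, Y)` when `Z` is uniform on `[0,1]^d` (density `1`)
and `Y | Z = z ∼ N(net θ z, 1)`. -/
def modelDensity {d k : ℕ} (θ : Params d k) (x : (Fin d → ℝ) × ℝ) : ℝ :=
  gaussianPDFReal (net θ x.1) 1 x.2

/-- The prior `Π_k` given `k` hidden nodes: all parameters are independent `N(0, τ²)`. -/
def paramPrior (d k : ℕ) (τ : ℝ≥0) : Measure (Params d k) :=
  (gaussianReal 0 (τ ^ 2)).prod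
    (Measure.pi fun _ : Fin k =>
      (gaussianReal 0 (τ ^ 2)).prod
        ((gaussianReal 0 (τ ^ 2)).prod (Measure.pi fun _ : Fin d => gaussianReal 0 (τ ^ 2))))

/-- `λ_i`, the prior probability of `i` hidden nodes, for the geometric distribution with success
probability `p` on `{0, 1, 2, …}`. -/
def nodeProb (p : unitInterval) (i : ℕ) : ℝ := (geometricMeasure p).real {i}

/-- The parameter space of the model in which the number of hidden nodes is a parameter too. -/
abbrev FullParams (d : ℕ) : Type := Σ k : ℕ, Params d k

/-- The joint prior `∑ₖ λₖ Πₖ`. -/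
def prior (d : ℕ) (p : unitInterval) (τ : ℝ≥0) : Measure (FullParams d) :=
  Measure.sum fun k => ENNReal.ofReal (nodeProb p k) • (paramPrior d k τ).map (Sigma.mk k)

/-- The likelihood `∏ᵢ f_θ(zᵢ, yᵢ)` of the observations `x`. -/
def likelihood {d n : ℕ} (x : Fin n → (Fin d → ℝ) × ℝ) (θ : FullParams d) : ℝ≥0∞ :=
  ∏ i, ENNReal.ofReal (modelDensity θ.2 (x i))

/-- The posterior distribution given the observations `x`: the prior reweighted by the likelihood
and normalized. -/
def posterior {d n : ℕ} (p : unitInterval) (τ : ℝ≥0) (x : Fin n → (Fin d → ℝ) × ℝ) :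
    Measure (FullParams d) :=
  (∫⁻ θ, likelihood x θ ∂prior d p τ)⁻¹ • (prior d p τ).withDensity (likelihood x)

/-- The Hellinger distance between two densities on `[0,1]^d × ℝ`. -/
def hellinger {d : ℕ} (f g : (Fin d → ℝ) × ℝ → ℝ) : ℝ :=
  √(∫ x, (√(f x) - √(g x)) ^ 2 ∂refMeasure d)

/-- The Hellinger neighbourhood `H_ε` of `f₀`, as a set of parameters. -/
def hellingerNhd {d : ℕ} (f₀ : (Fin d → ℝ) × ℝ → ℝ) (ε : ℝ) : Set (FullParams d) :=
  {θ | hellinger (modelDensity θ.2) f₀ ≤ ε}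

/-- The Kullback-Leibler neighbourhood `K_γ` of `f₀`, as a set of parameters of networks with
`k` hidden nodes. -/
def klNhd {d : ℕ} (k : ℕ) (f₀ : (Fin d → ℝ) × ℝ → ℝ) (γ : ℝ) : Set (Params d k) :=
  {θ | InformationTheory.klDiv (law f₀) (law (modelDensity θ)) ≤ ENNReal.ofReal γ}

/-- The networks with `k` hidden nodes that belong to the sieve `𝓕ₙ`: `k ≤ n ^ a`, and
`|a_{jh}| ≤ Cₙ` and `|β_j| ≤ Cₙ` for `1 ≤ j ≤ k` and `1 ≤ h ≤ d`. -/
def sieve (d k : ℕ) (a : ℝ) (C : ℕ → ℝ) (n : ℕ) : Set (Params d k) :=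
  {θ | (k : ℝ) ≤ (n : ℝ) ^ a ∧ ∀ j, |(θ.2 j).1| ≤ C n ∧ ∀ h, |(θ.2 j).2.2 h| ≤ C n}

end BNN

end

/-! After division by `∏ f₀(Zᵢ, Yᵢ)`, the posterior mass of the complement of `hellingerNhd` is a
quotient of two prior integrals of the likelihood ratio.

Denominator: by the strong law, the likelihood ratio of a network close to `f₀` in Kullback-Leibler
divergence eventually exceeds `exp (-nγ)`. By (A1) and (A4) the prior charges such networks for
every `γ > 0`, so with probability tending to one the denominator is at least `c exp (-nγ)` for some
`c > 0` (`tendsto_measure_evidence_lt`).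

Numerator: it is split along `energySieve`, the networks with at most `n` nodes and squared
parameter norm at most `R n`. Geometric and Gaussian tails make the prior mass outside exponentially
small, and likelihood ratios have mean at most one, so Markov's inequality applies. Inside, all
networks in a small supremum ball are dominated by one envelope, a Gaussian density of slightly
inflated variance and mass. If the ball contains a network outside `hellingerNhd`, the envelope
still has Hellinger affinity to `f₀` bounded away from one, so the root of its likelihood ratio has
exponentially small mean. A union bound over the balls then suffices, provided that there are only
`exp (o(n))` of them; see `tendsto_measure_posterior_ge`.

This entropy bound, `eventually_exists_unifCover_energyNets`, is the crux: rounding all of the order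
`n` parameters would cost `n log n`. Let `w` be a small power of `n`. At most `R n / w²` nodes have
an input weight above `w`; rounding their parameters costs about `(n / w²) log n`. The other nodes
are flat: on each cell of a grid of side `w⁻²` their sum is a polynomial of fixed degree up to a
small Taylor error, so only the number of cells counts, not the number of nodes. The total is `O(n /
w)`. -/

namespace PosteriorConsistency

/-! ### Posterior consistency in a general dominated model -/

variable {Ω 𝒳 Θ : Type*} [MeasurableSpace Ω] [MeasurableSpace 𝒳]

/-- The likelihood ratio of the first `n` observations. -/
noncomputable def lr (r : Θ → 𝒳 → ℝ) (X : ℕ → Ω → 𝒳) (n : ℕ) (θ : Θ) (ω : Ω) : ℝ≥0∞ :=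
  ∏ i ∈ Finset.range n, ENNReal.ofReal (r θ (X i ω))

lemma lintegral_prod_of_iid {P : Measure Ω} {X : ℕ → Ω → 𝒳}
    (hX : ∀ i, Measurable (X i)) (hind : iIndepFun X P) {μ : Measure 𝒳}
    (hlaw : ∀ i, P.map (X i) = μ) {φ : 𝒳 → ℝ≥0∞} (hφ : Measurable φ) (n : ℕ) :
    ∫⁻ ω, ∏ i ∈ Finset.range n, φ (X i ω) ∂P = (∫⁻ x, φ x ∂μ) ^ n := by
  have h := lintegral_prod_eq_prod_lintegral_of_indepFun (Finset.range n)
    (fun i ω => φ (X i ω)) (hind.comp (fun _ => φ) fun _ => hφ) fun i => hφ.comp (hX i)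
  rw [h]
  have : ∀ i, ∫⁻ ω, φ (X i ω) ∂P = ∫⁻ x, φ x ∂μ := fun i => by
    rw [← hlaw i, lintegral_map hφ (hX i)]
  simp [this]

/-- The strong law for the log-likelihood ratios: their averages converge almost surely to a mean
above `-γ`. -/
lemma lr_ge_eventually {P : Measure Ω} {X : ℕ → Ω → 𝒳}
    (hX : ∀ i, Measurable (X i)) (hind : iIndepFun X P) {μ : Measure 𝒳}
    (hlaw : ∀ i, P.map (X i) = μ) {r : Θ → 𝒳 → ℝ} {θ : Θ} (hr : Measurable (r θ))
    (hpos : ∀ᵐ x ∂μ, 0 < r θ x) (hint : Integrable (fun x => Real.log (r θ x)) μ) {γ : ℝ}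
    (hγ : -γ < ∫ x, Real.log (r θ x) ∂μ) :
    ∀ᵐ ω ∂P, ∀ᶠ n : ℕ in atTop, ENNReal.ofReal (Real.exp (-(n * γ))) ≤ lr r X n θ ω := by
  have hlog : Measurable fun x => Real.log (r θ x) := hr.log
  have hmp : ∀ i, MeasurePreserving (X i) P μ := fun i => ⟨hX i, hlaw i⟩
  have h0 : ∀ i, ∀ᵐ ω ∂P, 0 < r θ (X i ω) := fun i =>
    (hmp i).quasiMeasurePreserving.ae hpos
  have hint0 : Integrable (fun ω => Real.log (r θ (X 0 ω))) P :=
    (hmp 0).integrable_comp_of_integrable hint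
  have hE : ∫ ω, Real.log (r θ (X 0 ω)) ∂P = ∫ x, Real.log (r θ x) ∂μ := by
    rw [← hlaw 0, integral_map (hX 0).aemeasurable hlog.aestronglyMeasurable]
  have hslln := strong_law_ae_real (fun i ω => Real.log (r θ (X i ω))) hint0
    (fun i j hij => ((hind.indepFun hij).comp hlog hlog))
    (fun i => by
      have : IdentDistrib (X i) (X 0) P P :=
        ⟨(hX i).aemeasurable, (hX 0).aemeasurable, by rw [hlaw, hlaw]⟩
      exact this.comp hlog)
  filter_upwards [ae_all_iff.2 h0, hslln] with ω hω hlim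
  rw [hE] at hlim
  filter_upwards [hlim.eventually (lt_mem_nhds hγ), eventually_gt_atTop 0] with n hn hn0
  have hn0' : (0 : ℝ) < n := by exact_mod_cast hn0
  rw [lt_div_iff₀ hn0'] at hn
  unfold lr
  rw [← ENNReal.ofReal_prod_of_nonneg fun i _ => (hω i).le]
  refine ENNReal.ofReal_le_ofReal ?_
  rw [← Real.exp_log (Finset.prod_pos fun i _ => hω i), Real.exp_le_exp,
    Real.log_prod fun i _ => (hω i).ne']
  linarith

variable [MeasurableSpace Θ]

lemma measurable_lr {r : Θ → 𝒳 → ℝ} (hr : Measurable (Function.uncurry r)) {X : ℕ → Ω → 𝒳}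
    (hX : ∀ i, Measurable (X i)) (n : ℕ) :
    Measurable fun q : Θ × Ω => lr r X n q.1 q.2 := by
  unfold lr
  refine Finset.measurable_prod _ fun i _ => ENNReal.measurable_ofReal.comp ?_
  exact hr.comp (measurable_fst.prodMk ((hX i).comp measurable_snd))

/-- Lower bound for the evidence when the prior charges Kullback-Leibler neighbourhoods. -/
lemma tendsto_measure_evidence_lt {P : Measure Ω} [IsProbabilityMeasure P] {X : ℕ → Ω → 𝒳}
    (hX : ∀ i, Measurable (X i)) (hind : iIndepFun X P) {μ : Measure 𝒳}
    (hlaw : ∀ i, P.map (X i) = μ) {r : Θ → 𝒳 → ℝ} (hr : Measurable (Function.uncurry r))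
    (hpos : ∀ θ, ∀ᵐ x ∂μ, 0 < r θ x) (Q : Measure Θ) [IsFiniteMeasure Q] {γ : ℝ}
    (hKL : 0 < Q {θ | Integrable (fun x => Real.log (r θ x)) μ ∧
      -γ < ∫ x, Real.log (r θ x) ∂μ}) :
    ∃ c : ℝ≥0∞, 0 < c ∧ Tendsto (fun n : ℕ => P {ω | ∫⁻ θ, lr r X n θ ω ∂Q <
      ENNReal.ofReal (Real.exp (-(n * γ))) * c}) atTop (𝓝 0) := by
  set s : ℕ → ℝ≥0∞ := fun n => ENNReal.ofReal (Real.exp (-(n * γ))) with hs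
  set bad : ℕ → Set (Θ × Ω) := fun n => {q | lr r X n q.1 q.2 < s n} with hbad
  have hbadm : ∀ n, MeasurableSet (bad n) := fun n =>
    measurableSet_lt (measurable_lr hr hX n) measurable_const
  set g : ℕ → Θ → ℝ≥0∞ := fun n θ => P (Prod.mk θ ⁻¹' bad n) with hg
  have hgm : ∀ n, Measurable (g n) := fun n => measurable_measure_prodMk_left (hbadm n)
  -- `K` stands in for the Kullback-Leibler set: it contains that set and is measurable as the
  -- convergence set of measurable functions.
  set K : Set Θ := {θ | Tendsto (fun n => g n θ) atTop (𝓝 0)} with hK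
  have hKm : MeasurableSet K := measurableSet_tendsto (𝓝 0) hgm
  have hsub : {θ | Integrable (fun x => Real.log (r θ x)) μ ∧
      -γ < ∫ x, Real.log (r θ x) ∂μ} ⊆ K := by
    rintro θ ⟨h1, h2⟩
    have hrθ : Measurable (r θ) := hr.comp measurable_prodMk_left
    have hae := lr_ge_eventually hX hind hlaw hrθ (hpos θ) h1 h2
    have h := tendsto_measure_of_ae_tendsto_indicator (μ := P) atTop (A := ∅)
      MeasurableSet.empty (As := fun n => Prod.mk θ ⁻¹' bad n)
      (fun n => measurable_prodMk_left (hbadm n)) MeasurableSet.univ (measure_ne_top _ _)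
      (Eventually.of_forall fun n => subset_univ _) (by
        filter_upwards [hae] with ω hω
        filter_upwards [hω] with n hn
        simp [hbad, hs, hn])
    simpa [hK, hg] using h
  have hQK : 0 < Q K := hKL.trans_le (measure_mono hsub)
  have hQK' : Q K ≠ ∞ := measure_ne_top _ _
  refine ⟨Q K / 2, ENNReal.half_pos hQK.ne', ?_⟩
  have hlim : Tendsto (fun n => ∫⁻ θ in K, g n θ ∂Q) atTop (𝓝 0) := by
    have := tendsto_lintegral_of_dominated_convergence (μ := Q.restrict K) (F := g)
      (f := fun _ => 0) (fun _ => 1) hgm (fun n => Eventually.of_forall fun θ => prob_le_one)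
      (by simp) (by
        refine (ae_restrict_iff' hKm).2 (Eventually.of_forall fun θ hθ => hθ))
    simpa using this
  have hlim2 : Tendsto (fun n => (∫⁻ θ in K, g n θ ∂Q) / (Q K / 2)) atTop (𝓝 0) := by
    have := ENNReal.Tendsto.div_const hlim (b := Q K / 2) (Or.inr (ENNReal.half_pos hQK.ne').ne')
    simpa using this
  refine tendsto_of_tendsto_of_tendsto_of_le_of_le tendsto_const_nhds hlim2
    (fun _ => zero_le) fun n => ?_
  -- `m ω` is the prior mass within `K` of the parameters whose likelihood ratio is too small. Its
  -- mean tends to zero; where it is below `Q K / 2`, at least half of `K` contributes `s n` to the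
  -- evidence.
  set m : Ω → ℝ≥0∞ := fun ω => (Q.restrict K) ((fun θ => (θ, ω)) ⁻¹' bad n) with hm
  have hmm : Measurable m := measurable_measure_prodMk_right (hbadm n)
  have hE : ∫⁻ ω, m ω ∂P = ∫⁻ θ in K, g n θ ∂Q := by
    rw [hm, hg, ← Measure.prod_apply (hbadm n), Measure.prod_apply_symm (hbadm n)]
  rw [← hE]
  refine le_trans (measure_mono ?_) (meas_ge_le_lintegral_div hmm.aemeasurable
    (ENNReal.half_pos hQK.ne').ne' (ENNReal.div_ne_top hQK' two_ne_zero))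
  intro ω hω
  simp only [mem_ofPred_eq] at hω ⊢
  by_contra hlt
  push Not at hlt
  refine absurd hω (not_lt.2 ?_)
  set G : Set Θ := ((fun θ => (θ, ω)) ⁻¹' bad n)ᶜ with hG
  have hGm : MeasurableSet G := (measurable_prodMk_right (hbadm n)).compl
  have hQG : Q K / 2 ≤ Q.restrict K G := by
    have h1 : Q.restrict K Gᶜ + Q.restrict K G = Q K := by
      rw [add_comm, measure_add_measure_compl hGm, Measure.restrict_apply_univ]
    have h2 : Q.restrict K Gᶜ ≤ Q K / 2 := by
      rw [hG, compl_compl]; exact hlt.le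
    by_contra hcon
    push Not at hcon
    have : Q.restrict K Gᶜ + Q.restrict K G < Q K / 2 + Q K / 2 :=
      ENNReal.add_lt_add_of_le_of_lt (ne_top_of_le_ne_top (ENNReal.div_ne_top hQK' two_ne_zero) h2)
        h2 hcon
    rw [h1, ENNReal.add_halves] at this
    exact lt_irrefl _ this
  calc s n * (Q K / 2) ≤ s n * Q.restrict K G := by gcongr
    _ = ∫⁻ θ in G, s n ∂(Q.restrict K) := by rw [setLIntegral_const]
    _ ≤ ∫⁻ θ in G, lr r X n θ ω ∂(Q.restrict K) := by
        refine setLIntegral_mono' hGm fun θ hθ => ?_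
        simpa [hG, hbad] using hθ
    _ ≤ ∫⁻ θ, lr r X n θ ω ∂(Q.restrict K) := setLIntegral_le_lintegral _ _
    _ ≤ ∫⁻ θ, lr r X n θ ω ∂Q := setLIntegral_le_lintegral _ _

/-- Each likelihood ratio has mean at most one, so by Tonelli the integral over `S` has mean at most
`Q S`, and Markov's inequality applies. -/
lemma measure_lintegral_lr_ge_le {P : Measure Ω} [IsProbabilityMeasure P] {X : ℕ → Ω → 𝒳}
    (hX : ∀ i, Measurable (X i)) (hind : iIndepFun X P) {μ : Measure 𝒳}
    (hlaw : ∀ i, P.map (X i) = μ) {r : Θ → 𝒳 → ℝ} (hr : Measurable (Function.uncurry r))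
    (hle : ∀ θ, ∫⁻ x, ENNReal.ofReal (r θ x) ∂μ ≤ 1) (Q : Measure Θ) [IsFiniteMeasure Q]
    (S : Set Θ) (n : ℕ) {t : ℝ≥0∞} (ht : t ≠ 0) (ht' : t ≠ ∞) :
    P {ω | t ≤ ∫⁻ θ in S, lr r X n θ ω ∂Q} ≤ Q S / t := by
  have hm := measurable_lr hr hX n
  refine (meas_ge_le_lintegral_div (μ := P) (f := fun ω => ∫⁻ θ in S, lr r X n θ ω ∂Q)
    (Measurable.lintegral_prod_left' (f := fun q : Θ × Ω => lr r X n q.1 q.2) hm).aemeasurable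
    ht ht').trans ?_
  refine ENNReal.div_le_div_right ?_ _
  rw [lintegral_lintegral_swap (by
    exact (hm.comp measurable_swap).aemeasurable)]
  calc ∫⁻ θ in S, ∫⁻ ω, lr r X n θ ω ∂P ∂Q ≤ ∫⁻ θ in S, 1 ∂Q := by
        refine lintegral_mono fun θ => ?_
        have hrθ : Measurable fun x => ENNReal.ofReal (r θ x) :=
          (hr.comp measurable_prodMk_left).ennreal_ofReal
        unfold lr
        rw [lintegral_prod_of_iid hX hind hlaw hrθ n]
        exact pow_le_one' (hle θ) n
    _ = Q S := by simp

/-- Bound for the likelihood over a set covered by finitely many envelopes with small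
Hellinger affinity to the truth. -/
lemma measure_lintegral_lr_gt_le_of_envelopes {P : Measure Ω} [IsProbabilityMeasure P]
    {X : ℕ → Ω → 𝒳}
    (hX : ∀ i, Measurable (X i)) (hind : iIndepFun X P) {μ : Measure 𝒳}
    (hlaw : ∀ i, P.map (X i) = μ) {r : Θ → 𝒳 → ℝ}
    (Q : Measure Θ) [IsProbabilityMeasure Q] {S : Set Θ} (hS : MeasurableSet S)
    {ι : Type*} [Fintype ι] (F : ι → 𝒳 → ℝ≥0∞) (hF : ∀ c, Measurable (F c))
    (hcov : ∀ θ ∈ S, ∃ c, ∀ x, ENNReal.ofReal (r θ x) ≤ F c x) {ρ : ℝ≥0∞}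
    (hρ : ∀ c, ∫⁻ x, F c x ^ (2⁻¹ : ℝ) ∂μ ≤ ρ)
    (n : ℕ) {t : ℝ≥0∞} (ht : t ≠ 0) (ht' : t ≠ ∞) :
    P {ω | Fintype.card ι * t ^ (2 : ℝ) < ∫⁻ θ in S, lr r X n θ ω ∂Q} ≤
      Fintype.card ι * (ρ ^ n / t) := by
  set A : ι → Ω → ℝ≥0∞ := fun c ω => ∏ i ∈ Finset.range n, F c (X i ω) with hA
  have hAm : ∀ c, Measurable (A c) := fun c =>
    Finset.measurable_prod _ fun i _ => (hF c).comp (hX i)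
  -- The integral is at most the sum of the products `A c`; if every root is below `t`, this sum is
  -- at most `card ι * t²`. Roots are used because their means are controlled by the affinities.
  have hsub : {ω | Fintype.card ι * t ^ (2 : ℝ) < ∫⁻ θ in S, lr r X n θ ω ∂Q} ⊆
      ⋃ c, {ω | t ≤ A c ω ^ (2⁻¹ : ℝ)} := by
    intro ω hω
    by_contra hcon
    simp only [mem_iUnion, mem_ofPred_eq, not_exists, not_le] at hcon hω
    refine absurd hω (not_lt.2 ?_)
    calc ∫⁻ θ in S, lr r X n θ ω ∂Q ≤ ∫⁻ θ in S, ∑ c, A c ω ∂Q := by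
          refine setLIntegral_mono' hS fun θ hθ => ?_
          obtain ⟨c, hc⟩ := hcov θ hθ
          refine le_trans (Finset.prod_le_prod' fun i _ => hc _) ?_
          exact Finset.single_le_sum (f := fun c => A c ω) (fun _ _ => zero_le)
            (Finset.mem_univ c)
      _ ≤ ∑ c, A c ω := by
          rw [setLIntegral_const]
          exact mul_le_of_le_one_right' prob_le_one
      _ ≤ ∑ _c : ι, t ^ (2 : ℝ) := by
          refine Finset.sum_le_sum fun c _ => ?_
          have := ENNReal.rpow_le_rpow (hcon c).le (by norm_num : (0 : ℝ) ≤ 2)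
          rwa [← ENNReal.rpow_mul, inv_mul_cancel₀ two_ne_zero, ENNReal.rpow_one] at this
      _ = Fintype.card ι * t ^ (2 : ℝ) := by simp
  refine (measure_mono hsub).trans ((measure_iUnion_fintype_le _ _).trans ?_)
  calc ∑ c, P {ω | t ≤ A c ω ^ (2⁻¹ : ℝ)} ≤ ∑ _c : ι, ρ ^ n / t := by
        refine Finset.sum_le_sum fun c _ => ?_
        refine (meas_ge_le_lintegral_div ((hAm c).pow_const _).aemeasurable ht ht').trans ?_
        refine ENNReal.div_le_div_right ?_ _
        have h : ∀ ω, A c ω ^ (2⁻¹ : ℝ) =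
            ∏ i ∈ Finset.range n, (fun x => F c x ^ (2⁻¹ : ℝ)) (X i ω) := fun ω =>
          (ENNReal.prod_rpow_of_nonneg (by norm_num)).symm
        simp_rw [h]
        rw [lintegral_prod_of_iid hX hind hlaw ((hF c).pow_const _) n]
        gcongr
        exact hρ c
    _ = Fintype.card ι * (ρ ^ n / t) := by simp


/-- Abstract posterior consistency: if the prior charges Kullback-Leibler neighbourhoods and
`U` is covered, up to sets of exponentially small prior mass, by subexponentially many envelopes
whose Hellinger affinity to the truth is bounded away from one, then the posterior probability
of `U` tends to zero in probability. -/
theorem tendsto_measure_posterior_ge {P : Measure Ω} [IsProbabilityMeasure P] {X : ℕ → Ω → 𝒳}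
    (hX : ∀ i, Measurable (X i)) (hind : iIndepFun X P) {μ : Measure 𝒳}
    (hlaw : ∀ i, P.map (X i) = μ) {r : Θ → 𝒳 → ℝ} (hr : Measurable (Function.uncurry r))
    (hpos : ∀ θ, ∀ᵐ x ∂μ, 0 < r θ x) (hle : ∀ θ, ∫⁻ x, ENNReal.ofReal (r θ x) ∂μ ≤ 1)
    (Q : Measure Θ) [IsProbabilityMeasure Q]
    (hKL : ∀ γ : ℝ, 0 < γ → 0 < Q {θ | Integrable (fun x => Real.log (r θ x)) μ ∧
      -γ < ∫ x, Real.log (r θ x) ∂μ})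
    {U : Set Θ} (hU : MeasurableSet U) (S : ℕ → Set Θ) (hS : ∀ n, MeasurableSet (S n))
    {c₀ l : ℝ} (hc₀ : 0 < c₀) (hl : 0 < l)
    (hSc : ∀ᶠ n : ℕ in atTop, Q (S n)ᶜ ≤ ENNReal.ofReal (Real.exp (-(n * c₀))))
    (hcov : ∀ᶠ n : ℕ in atTop, ∃ (N : ℕ) (F : Fin N → 𝒳 → ℝ≥0∞),
      (N : ℝ) ≤ Real.exp (n * (l / 4)) ∧ (∀ c, Measurable (F c)) ∧
      (∀ θ ∈ S n ∩ U, ∃ c, ∀ x, ENNReal.ofReal (r θ x) ≤ F c x) ∧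
      ∀ c, ∫⁻ x, F c x ^ (2⁻¹ : ℝ) ∂μ ≤ ENNReal.ofReal (Real.exp (-l)))
    {δ : ℝ≥0∞} (hδ : 0 < δ) :
    Tendsto (fun n : ℕ => P {ω | δ * ∫⁻ θ, lr r X n θ ω ∂Q ≤ ∫⁻ θ in U, lr r X n θ ω ∂Q})
      atTop (𝓝 0) := by
  -- `c₀ / 2` and `3 l / 4` are the decay rates of the numerator off and on the sieve. Taking the
  -- evidence at rate `m / 2` leaves a factor `exp (-n m / 2)` to spare.
  obtain ⟨m, hm0, hm1, hm2⟩ : ∃ m : ℝ, 0 < m ∧ m ≤ c₀ / 2 ∧ m ≤ 3 * l / 4 :=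
    ⟨min (c₀ / 2) (3 * l / 4), by positivity, min_le_left _ _, min_le_right _ _⟩
  obtain ⟨c, hc, hev⟩ := tendsto_measure_evidence_lt hX hind hlaw hr hpos Q
    (hKL (m / 2) (by positivity))
  have hexp : ∀ a : ℝ, 0 < a → Tendsto (fun n : ℕ => ENNReal.ofReal (Real.exp (-(n * a))))
      atTop (𝓝 0) := by
    intro a ha
    rw [← ENNReal.ofReal_zero]
    refine ENNReal.tendsto_ofReal (Real.tendsto_exp_atBot.comp ?_)
    exact tendsto_neg_atTop_atBot.comp (tendsto_natCast_atTop_atTop.atTop_mul_const ha)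
  have hsum := (hev.add (hexp (c₀ / 2) (by positivity))).add (hexp (l / 4) (by positivity))
  simp only [add_zero] at hsum
  have hδc : 0 < δ * c / 2 := ENNReal.half_pos (mul_ne_zero hδ.ne' hc.ne')
  refine tendsto_of_tendsto_of_tendsto_of_le_of_le' tendsto_const_nhds hsum
    (Eventually.of_forall fun _ => zero_le) ?_
  filter_upwards [hSc, hcov, (hexp (m / 2) (by positivity)).eventually (gt_mem_nhds hδc)]
    with n hn1 ⟨N, F, hN, hFm, hFcov, hF⟩ hn3
  have e : ∀ a b : ℝ, ENNReal.ofReal (Real.exp a) * ENNReal.ofReal (Real.exp b) =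
      ENNReal.ofReal (Real.exp (a + b)) := fun a b => by
    rw [← ENNReal.ofReal_mul (Real.exp_pos a).le, Real.exp_add]
  have e0 : ∀ a : ℝ, ENNReal.ofReal (Real.exp a) ≠ 0 := fun a => by
    simp [Real.exp_pos]
  have edl : ∀ a b : ℝ, ENNReal.ofReal (Real.exp a) / ENNReal.ofReal (Real.exp b) =
      ENNReal.ofReal (Real.exp (a - b)) := fun a b => by
    rw [← ENNReal.ofReal_div_of_pos (Real.exp_pos b), Real.exp_sub]
  have hA := measure_lintegral_lr_ge_le hX hind hlaw hr hle Q (S n)ᶜ n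
    (t := ENNReal.ofReal (Real.exp (-(n * (c₀ / 2))))) (e0 _) ENNReal.ofReal_ne_top
  have hA' : P {ω | ENNReal.ofReal (Real.exp (-(n * (c₀ / 2)))) ≤
      ∫⁻ θ in (S n)ᶜ, lr r X n θ ω ∂Q} ≤ ENNReal.ofReal (Real.exp (-(n * (c₀ / 2)))) := by
    refine hA.trans ((ENNReal.div_le_div_right hn1 _).trans ?_)
    rw [edl]
    refine ENNReal.ofReal_le_ofReal (Real.exp_le_exp.2 (by linarith))
  have hNe : ((Fintype.card (Fin N) : ℕ) : ℝ≥0∞) ≤ ENNReal.ofReal (Real.exp (n * (l / 4))) := by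
    rw [Fintype.card_fin, ← ENNReal.ofReal_natCast]
    exact ENNReal.ofReal_le_ofReal hN
  -- With `t = exp (-n l / 2)` and at most `exp (n l / 4)` envelopes, the threshold has exponent `n
  -- (l / 4 - l) = -3 n l / 4` and the probability `n (l / 4 - l + l / 2) = -n l / 4`.
  have hB := measure_lintegral_lr_gt_le_of_envelopes hX hind hlaw Q ((hS n).inter hU) F hFm hFcov
    hF n (t := ENNReal.ofReal (Real.exp (-(n * (l / 2))))) (e0 _) ENNReal.ofReal_ne_top
  have hB' : P {ω | ENNReal.ofReal (Real.exp (-(n * (3 * l / 4)))) <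
      ∫⁻ θ in S n ∩ U, lr r X n θ ω ∂Q} ≤ ENNReal.ofReal (Real.exp (-(n * (l / 4)))) := by
    refine (measure_mono ?_).trans (hB.trans ?_)
    · intro ω hω
      rw [mem_ofPred_eq] at hω ⊢
      refine lt_of_le_of_lt ?_ hω
      rw [ENNReal.ofReal_rpow_of_pos (Real.exp_pos _), ← Real.exp_mul]
      refine (mul_le_mul_left hNe _).trans ?_
      rw [e]
      exact ENNReal.ofReal_le_ofReal (Real.exp_le_exp.2 (by linarith))
    · rw [← ENNReal.ofReal_pow (Real.exp_pos _).le, ← Real.exp_nat_mul, edl]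
      refine (mul_le_mul_left hNe _).trans ?_
      rw [e]
      exact ENNReal.ofReal_le_ofReal (Real.exp_le_exp.2 (by linarith))
  refine le_trans ?_ (add_le_add (add_le_add le_rfl hA') hB')
  refine le_trans (measure_mono ?_) ((measure_union_le _ _).trans
    (add_le_add (measure_union_le _ _) le_rfl))
  intro ω hω
  by_contra hcon
  simp only [mem_union, not_or, mem_ofPred_eq, not_lt, not_le] at hcon hω
  obtain ⟨⟨h1, h2⟩, h3⟩ := hcon
  have hUle : ∫⁻ θ in U, lr r X n θ ω ∂Q ≤ 2 * ENNReal.ofReal (Real.exp (-(n * m))) := by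
    calc ∫⁻ θ in U, lr r X n θ ω ∂Q ≤ ∫⁻ θ in (S n)ᶜ ∪ (S n ∩ U), lr r X n θ ω ∂Q := by
          refine lintegral_mono_set fun θ hθ => ?_
          by_cases h : θ ∈ S n
          · exact Or.inr ⟨h, hθ⟩
          · exact Or.inl h
      _ ≤ _ := lintegral_union_le _ _ _
      _ ≤ ENNReal.ofReal (Real.exp (-(n * m))) + ENNReal.ofReal (Real.exp (-(n * m))) := by
          refine add_le_add (h2.le.trans ?_) (h3.trans ?_) <;>
          refine ENNReal.ofReal_le_ofReal (Real.exp_le_exp.2 ?_) <;>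
          gcongr
      _ = _ := (two_mul _).symm
  have hfin : δ * (ENNReal.ofReal (Real.exp (-(n * (m / 2)))) * c) ≤
      2 * ENNReal.ofReal (Real.exp (-(n * m))) :=
    (mul_le_mul_right h1 _).trans (hω.trans hUle)
  have hsplit : ENNReal.ofReal (Real.exp (-(n * m))) =
      ENNReal.ofReal (Real.exp (-(n * (m / 2)))) * ENNReal.ofReal (Real.exp (-(n * (m / 2)))) := by
    rw [e]; congr 2; ring
  rw [hsplit, mul_left_comm, mul_left_comm 2,
    ENNReal.mul_le_mul_iff_right (e0 _) ENNReal.ofReal_ne_top] at hfin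
  have := (ENNReal.div_le_of_le_mul' hfin)
  exact absurd hn3 (not_lt.2 this)

end PosteriorConsistency

/-! ### Covers in the supremum distance -/

/-- `A` is covered by `N` balls of radius `δ` in the supremum distance on `D`. -/
def UnifCover {E : Type*} (D : Set E) (A : Set (E → ℝ)) (δ : ℝ) (N : ℕ) : Prop :=
  ∃ s : Fin N → E → ℝ, ∀ g ∈ A, ∃ c, ∀ z ∈ D, |g z - s c z| ≤ δ

namespace UnifCover

variable {E : Type*} {D : Set E}

lemma of_fintype {A : Set (E → ℝ)} {δ : ℝ} {T : Type*} [Fintype T] (s : T → E → ℝ)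
    (h : ∀ g ∈ A, ∃ c, ∀ z ∈ D, |g z - s c z| ≤ δ) : UnifCover D A δ (Fintype.card T) := by
  refine ⟨fun i => s ((Fintype.equivFin T).symm i), fun g hg => ?_⟩
  obtain ⟨c, hc⟩ := h g hg
  exact ⟨Fintype.equivFin T c, by simpa using hc⟩

lemma mono {A : Set (E → ℝ)} {δ δ' : ℝ} {N : ℕ} (h : UnifCover D A δ N) (hδ : δ ≤ δ') :
    UnifCover D A δ' N := by
  obtain ⟨s, hs⟩ := h
  refine ⟨s, fun g hg => ?_⟩
  obtain ⟨c, hc⟩ := hs g hg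
  exact ⟨c, fun z hz => (hc z hz).trans hδ⟩

lemma add {A B C : Set (E → ℝ)} {δ₁ δ₂ δ₃ : ℝ} {N₁ N₂ : ℕ} (hB : UnifCover D B δ₁ N₁)
    (hC : UnifCover D C δ₂ N₂)
    (h : ∀ g ∈ A, ∃ b ∈ B, ∃ c ∈ C, ∀ z ∈ D, |g z - (b z + c z)| ≤ δ₃) :
    UnifCover D A (δ₁ + δ₂ + δ₃) (N₁ * N₂) := by
  obtain ⟨s, hs⟩ := hB
  obtain ⟨t, ht⟩ := hC
  have := of_fintype (D := D) (A := A) (δ := δ₁ + δ₂ + δ₃)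
    (fun q : Fin N₁ × Fin N₂ => fun z => s q.1 z + t q.2 z) (by
      intro g hg
      obtain ⟨b, hb, c, hc, hbc⟩ := h g hg
      obtain ⟨i, hi⟩ := hs b hb
      obtain ⟨j, hj⟩ := ht c hc
      refine ⟨(i, j), fun z hz => ?_⟩
      have e : g z - (s i z + t j z) =
        (b z - s i z) + (c z - t j z) + (g z - (b z + c z)) := by ring
      simp only [e]
      exact (abs_add_three _ _ _).trans (add_le_add (add_le_add (hi z hz) (hj z hz)) (hbc z hz)))
  simpa using this

/-- Covering the image of a cube of parameters by rounding the parameters to a grid. -/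
lemma of_box {ι : Type*} [Fintype ι] {M η δ : ℝ} (hη : 0 < η) (Φ : (ι → ℝ) → E → ℝ)
    (hΦ : ∀ b b' : ι → ℝ, (∀ i, |b i| ≤ M) → (∀ i, |b' i| ≤ M) → (∀ i, |b i - b' i| ≤ η) →
      ∀ z ∈ D, |Φ b z - Φ b' z| ≤ δ) :
    UnifCover D {g | ∃ b : ι → ℝ, (∀ i, |b i| ≤ M) ∧ g = Φ b} δ
      ((⌊2 * M / η⌋₊ + 1) ^ Fintype.card ι) := by
  classical
  have key := of_fintype (D := D) (A := {g | ∃ b : ι → ℝ, (∀ i, |b i| ≤ M) ∧ g = Φ b}) (δ := δ)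
    -- Rounding down from `-M` keeps the grid point between `-M` and `b i`, so it stays in the cube,
    -- as `hΦ` requires.
    (fun (c : ι → Fin (⌊2 * M / η⌋₊ + 1)) => Φ fun i => -M + η * (c i : ℕ)) (by
      rintro g ⟨b, hb, rfl⟩
      have h0 : ∀ i, 0 ≤ (b i + M) / η := fun i =>
        div_nonneg (by linarith [neg_le_of_abs_le (hb i)]) hη.le
      have hle : ∀ i, ⌊(b i + M) / η⌋₊ ≤ ⌊2 * M / η⌋₊ := fun i => by
        refine Nat.floor_le_floor ?_
        gcongr
        linarith [le_of_abs_le (hb i)]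
      have h1 : ∀ i, η * (⌊(b i + M) / η⌋₊ : ℕ) ≤ b i + M := fun i => by
        have := Nat.floor_le (h0 i)
        rwa [le_div_iff₀ hη, mul_comm] at this
      have h2 : ∀ i, b i + M ≤ η * (⌊(b i + M) / η⌋₊ : ℕ) + η := fun i => by
        have := (Nat.lt_floor_add_one ((b i + M) / η)).le
        rw [div_le_iff₀ hη] at this
        linarith
      have h3 : ∀ i, 0 ≤ η * (⌊(b i + M) / η⌋₊ : ℕ) := fun i => by positivity
      refine ⟨fun i => ⟨⌊(b i + M) / η⌋₊, Nat.lt_succ_of_le (hle i)⟩, hΦ _ _ hb ?_ ?_⟩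
      · intro i
        rw [abs_le]
        constructor
        · linarith [h3 i]
        · linarith [h1 i, le_of_abs_le (hb i)]
      · intro i
        rw [abs_le]
        constructor
        · linarith [h1 i]
        · linarith [h2 i])
  simpa using key

end UnifCover

/-! ### Taylor expansion of the logistic function -/

/-- Taylor expansion of a polynomial in the logistic function, with uniformly bounded
coefficients and remainder. -/
lemma exists_taylor_eval_sigmoid (s : ℕ) : ∀ p : Polynomial ℝ, ∃ (c : ℕ → ℝ → ℝ) (B : ℝ), 0 ≤ B ∧
    (∀ l u, |c l u| ≤ B) ∧ ∀ u t, |p.eval (Real.sigmoid (u + t)) -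
      ∑ l ∈ Finset.range s, c l u * t ^ l| ≤ B * |t| ^ s := by
  have hbd : ∀ p : Polynomial ℝ, ∃ B : ℝ, 0 ≤ B ∧ ∀ u, |p.eval (Real.sigmoid u)| ≤ B := by
    intro p
    obtain ⟨B, hB⟩ := (isCompact_Icc (a := (0 : ℝ)) (b := 1)).exists_bound_of_continuousOn
      (f := fun x => p.eval x) p.continuous.continuousOn
    have h : ∀ u, |p.eval (Real.sigmoid u)| ≤ B := fun u =>
      hB _ ⟨Real.sigmoid_nonneg u, Real.sigmoid_le_one u⟩
    exact ⟨B, (abs_nonneg _).trans (h 0), h⟩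
  induction s with
  | zero =>
    intro p
    obtain ⟨B, hB0, hB⟩ := hbd p
    exact ⟨fun _ _ => 0, B, hB0, by simpa using hB0, fun u t => by simpa using hB (u + t)⟩
  | succ s ih =>
    intro p
    obtain ⟨B', hB0', hB'⟩ := hbd p
    -- Since `σ' = σ (1 - σ)`, the derivative of `p ∘ σ` is again a polynomial in `σ`; this closes
    -- the induction. Its expansion is integrated term by term, and the mean value inequality turns
    -- its remainder into one of the next order.
    obtain ⟨c, B, hB0, hc, hB⟩ := ih (p.derivative * (.X * (1 - .X)))
    refine ⟨fun l u => if l = 0 then p.eval (Real.sigmoid u) else c (l - 1) u / l, max B B',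
      hB0.trans (le_max_left _ _), ?_, ?_⟩
    · intro l u
      by_cases hl : l = 0
      · simpa [hl] using Or.inr (hB' u)
      · simp only [hl, if_false]
        rw [abs_div, Nat.abs_cast]
        refine le_max_of_le_left ((div_le_self (abs_nonneg _) ?_).trans (hc _ _))
        exact_mod_cast Nat.one_le_iff_ne_zero.2 hl
    · intro u t
      set f : ℝ → ℝ := fun x => p.eval (Real.sigmoid (u + x)) -
        ∑ l ∈ Finset.range (s + 1), (if l = 0 then p.eval (Real.sigmoid u) else c (l - 1) u / l) *
          x ^ l with hf
      set f' : ℝ → ℝ := fun x => (p.derivative * (.X * (1 - .X))).eval (Real.sigmoid (u + x)) -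
        ∑ l ∈ Finset.range s, c l u * x ^ l with hf'
      have hder : ∀ x, HasDerivAt f (f' x) x := by
        intro x
        refine HasDerivAt.sub ?_ ?_
        · have h1 : HasDerivAt (fun x => Real.sigmoid (u + x))
              (Real.sigmoid (u + x) * (1 - Real.sigmoid (u + x))) x := by
            have := (Real.hasDerivAt_sigmoid (u + x)).comp_const_add u x
            exact this
          have h2 := (p.hasDerivAt (Real.sigmoid (u + x))).comp x h1
          simpa [Function.comp_def] using h2
        · simp only [Finset.sum_range_succ']
          simp only [Nat.add_eq_zero_iff, one_ne_zero, and_false, if_false, if_true,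
            Nat.add_sub_cancel, pow_zero]
          refine HasDerivAt.add_const _ ?_
          refine HasDerivAt.fun_sum fun l _ => ?_
          have h := (hasDerivAt_pow (l + 1) x).const_mul (c l u / ((l + 1 : ℕ) : ℝ))
          refine h.congr_deriv ?_
          have : ((l + 1 : ℕ) : ℝ) ≠ 0 := by positivity
          rw [Nat.add_sub_cancel, ← mul_assoc, div_mul_cancel₀ _ this]
      have h0 : f 0 = 0 := by
        simp [hf, Finset.sum_range_succ']
      have hmv := (convex_uIcc (0 : ℝ) t).norm_image_sub_le_of_norm_hasDerivWithin_le
        (f := f) (f' := f') (C := B * |t| ^ s)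
        (fun x _ => (hder x).hasDerivWithinAt) (fun x hx => by
          refine (hB u x).trans ?_
          have : |x| ≤ |t| := by
            have := abs_sub_left_of_mem_uIcc hx
            simpa using this
          gcongr) left_mem_uIcc right_mem_uIcc
      rw [h0, sub_zero, sub_zero, Real.norm_eq_abs, Real.norm_eq_abs, mul_assoc, ← pow_succ] at hmv
      refine hmv.trans ?_
      gcongr
      exact le_max_left _ _

lemma exists_taylor_sigmoid (s : ℕ) : ∃ (c : ℕ → ℝ → ℝ) (B : ℝ), 0 ≤ B ∧
    (∀ l u, |c l u| ≤ B) ∧ ∀ u t, |Real.sigmoid (u + t) -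
      ∑ l ∈ Finset.range s, c l u * t ^ l| ≤ B * |t| ^ s := by
  simpa using exists_taylor_eval_sigmoid s .X

lemma abs_sigmoid_sub_le (u v : ℝ) : |Real.sigmoid u - Real.sigmoid v| ≤ |u - v| := by
  have := convex_univ.norm_image_sub_le_of_norm_hasDerivWithin_le (f := Real.sigmoid)
    (f' := fun x => Real.sigmoid x * (1 - Real.sigmoid x)) (C := 1) (x := v) (y := u)
    (fun x _ => (Real.hasDerivAt_sigmoid x).hasDerivWithinAt) (fun x _ => by
      rw [Real.norm_eq_abs, abs_of_nonneg (mul_nonneg (Real.sigmoid_nonneg x)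
        (sub_nonneg.2 (Real.sigmoid_le_one x)))]
      nlinarith [Real.sigmoid_nonneg x, Real.sigmoid_le_one x]) (mem_univ _) (mem_univ _)
  simpa using this

/-! ### Covers of flat networks and of networks with few nodes -/

namespace BNN

/-- The networks without intercept whose input weights are bounded by `w` and whose output weights
have absolute sum at most `T`. -/
def flatNets (d : ℕ) (w T : ℝ) : Set ((Fin d → ℝ) → ℝ) :=
  {g | ∃ (k : ℕ) (J : Finset (Fin k)) (θ : Fin k → ℝ × ℝ × (Fin d → ℝ)),
    (∀ j ∈ J, ∀ h, |(θ j).2.2 h| ≤ w) ∧ ∑ j ∈ J, |(θ j).1| ≤ T ∧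
    g = fun z => ∑ j ∈ J, (θ j).1 * Real.sigmoid ((θ j).2.1 + ∑ h, (θ j).2.2 h * z h)}

/-- The cell of the regular grid of side `1 / q` that contains `z`. -/
noncomputable def gridCell {d : ℕ} (q : ℕ) (z : Fin d → ℝ) : Fin d → Fin (q + 1) :=
  fun h => Fin.ofNat (q + 1) ⌊z h * q⌋₊

lemma abs_sub_gridCell_le {d q : ℕ} (hq : 0 < q) {z : Fin d → ℝ} (hz : z ∈ Icc (0 : Fin d → ℝ) 1)
    (h : Fin d) : |z h - ((gridCell q z h : ℕ) : ℝ) / q| ≤ 1 / q := by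
  have hq' : (0 : ℝ) < q := by exact_mod_cast hq
  have h0 : 0 ≤ z h := hz.1 h
  have h1 : z h ≤ 1 := hz.2 h
  have hzq : 0 ≤ z h * q := by positivity
  have hle : ⌊z h * q⌋₊ ≤ q := by
    have : z h * q ≤ q := by nlinarith
    exact_mod_cast (Nat.floor_le hzq).trans this
  -- `Fin.ofNat` reduces modulo `q + 1`, which has no effect on the cube; the extra index `q` is for
  -- `z h = 1`.
  have hv : (gridCell q z h : ℕ) = ⌊z h * q⌋₊ := by
    simp only [gridCell, Fin.ofNat]
    exact Nat.mod_eq_of_lt (Nat.lt_succ_of_le hle)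
  rw [hv]
  have e : z h - (⌊z h * q⌋₊ : ℝ) / q = (z h * q - ⌊z h * q⌋₊) / q := by field_simp
  rw [e, abs_div, abs_of_pos hq']
  gcongr
  rw [abs_le]
  constructor <;> linarith [Nat.floor_le hzq, Nat.lt_floor_add_one (z h * q)]

/-- Flat networks are covered by piecewise polynomials with rounded coefficients. -/
lemma exists_unifCover_flatNets (d s : ℕ) : ∃ (D : ℕ) (B : ℝ), 0 ≤ B ∧
    ∀ (q : ℕ) (w T η : ℝ), 0 < q → 1 ≤ w → 0 ≤ T → 0 < η →
      UnifCover (Icc 0 1) (flatNets d w T) (D * η + T * (B * (d * w / q) ^ s))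
        ((⌊2 * (T * (B * w ^ s)) / η⌋₊ + 1) ^ ((q + 1) ^ d * D)) := by
  obtain ⟨c, B, hB0, hc, hB⟩ := exists_taylor_sigmoid s
  -- A monomial of degree `l < s` is indexed by a word of `l` coordinates, which is how the `l`-th
  -- power of a linear form expands.
  set I : Type := Σ l : Fin s, Fin l → Fin d with hI
  refine ⟨Fintype.card I, B, hB0, fun q w T η hq hw hT hη => ?_⟩
  have hq' : (0 : ℝ) < q := by exact_mod_cast hq
  have hq1 : (1 : ℝ) ≤ q := by exact_mod_cast hq
  set v : (Fin d → ℝ) → Fin d → ℝ := fun z h => z h - ((gridCell q z h : ℕ) : ℝ) / q with hv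
  have hv1 : ∀ z ∈ Icc (0 : Fin d → ℝ) 1, ∀ h, |v z h| ≤ 1 / q := fun z hz h =>
    abs_sub_gridCell_le hq hz h
  have hv2 : ∀ z ∈ Icc (0 : Fin d → ℝ) 1, ∀ h, |v z h| ≤ 1 := fun z hz h =>
    (hv1 z hz h).trans ((div_le_one hq').2 hq1)
  set Φ : ((Fin d → Fin (q + 1)) × I → ℝ) → (Fin d → ℝ) → ℝ := fun b z =>
    ∑ x : I, b (gridCell q z, x) * ∏ i, v z (x.2 i) with hΦ
  have hbox := UnifCover.of_box (D := Icc (0 : Fin d → ℝ) 1) (M := T * (B * w ^ s)) hη Φ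
    (δ := Fintype.card I * η) (by
      intro b b' _ _ hbb z hz
      simp only [hΦ, ← Finset.sum_sub_distrib, ← sub_mul]
      refine (Finset.abs_sum_le_sum_abs _ _).trans ?_
      calc _ ≤ ∑ _x : I, η := by
            refine Finset.sum_le_sum fun x _ => ?_
            rw [abs_mul, Finset.abs_prod]
            calc _ ≤ η * 1 := by
                  refine mul_le_mul (hbb _) ?_ (Finset.prod_nonneg fun _ _ => abs_nonneg _) hη.le
                  exact Finset.prod_le_one (fun _ _ => abs_nonneg _) fun i _ => hv2 z hz _
              _ = η := mul_one _
        _ = _ := by simp)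
  have hcard : Fintype.card ((Fin d → Fin (q + 1)) × I) = (q + 1) ^ d * Fintype.card I := by
    simp
  rw [hcard] at hbox
  obtain ⟨S, hS⟩ := hbox
  refine ⟨S, ?_⟩
  rintro g ⟨k, J, θ, hw', hT', rfl⟩
  set u : Fin k → (Fin d → Fin (q + 1)) → ℝ := fun j κ =>
    (θ j).2.1 + ∑ h, (θ j).2.2 h * (((κ h : ℕ) : ℝ) / q) with hu
  -- The Taylor coefficients of all nodes are summed into one coefficient per cell and monomial, so
  -- the number of nodes drops out and only the total output weight matters.
  set b : (Fin d → Fin (q + 1)) × I → ℝ := fun x =>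
    ∑ j ∈ J, (θ j).1 * (c x.2.1 (u j x.1) * ∏ i, (θ j).2.2 (x.2.2 i)) with hb
  have hbM : ∀ x, |b x| ≤ T * (B * w ^ s) := by
    intro x
    refine (Finset.abs_sum_le_sum_abs _ _).trans ?_
    refine le_trans ?_ (mul_le_mul_of_nonneg_right hT' (by positivity))
    rw [Finset.sum_mul]
    refine Finset.sum_le_sum fun j hj => ?_
    rw [abs_mul, abs_mul, Finset.abs_prod]
    gcongr
    · exact hc _ _
    · calc _ ≤ ∏ _i : Fin x.2.1, w :=
            Finset.prod_le_prod (fun _ _ => abs_nonneg _) fun i _ => hw' j hj _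
        _ = w ^ (x.2.1 : ℕ) := by simp
        _ ≤ w ^ s := pow_le_pow_right₀ hw x.2.1.2.le
  obtain ⟨i, hi⟩ := hS (Φ b) ⟨b, hbM, rfl⟩
  refine ⟨i, fun z hz => ?_⟩
  have happ : |(∑ j ∈ J, (θ j).1 * Real.sigmoid ((θ j).2.1 + ∑ h, (θ j).2.2 h * z h)) - Φ b z| ≤
      T * (B * (d * w / q) ^ s) := by
    set t : Fin k → ℝ := fun j => ∑ h, (θ j).2.2 h * v z h with ht
    have hlin : ∀ j, (θ j).2.1 + ∑ h, (θ j).2.2 h * z h = u j (gridCell q z) + t j := by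
      intro j
      simp only [hu, ht, hv, add_assoc, ← Finset.sum_add_distrib]
      congr 1
      refine Finset.sum_congr rfl fun h _ => by ring
    have hΦb : Φ b z = ∑ j ∈ J, (θ j).1 *
        ∑ l ∈ Finset.range s, c l (u j (gridCell q z)) * t j ^ l := by
      simp only [hΦ, hb, Finset.sum_mul]
      rw [Finset.sum_comm]
      refine Finset.sum_congr rfl fun j _ => ?_
      rw [Finset.sum_range, Finset.mul_sum, Fintype.sum_sigma]
      refine Finset.sum_congr rfl fun l _ => ?_
      simp only [ht, Fintype.sum_pow, Finset.mul_sum]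
      refine Finset.sum_congr rfl fun φ _ => ?_
      rw [Finset.prod_mul_distrib]
      ring
    rw [hΦb, ← Finset.sum_sub_distrib]
    refine (Finset.abs_sum_le_sum_abs _ _).trans ?_
    refine le_trans ?_ (mul_le_mul_of_nonneg_right hT' (by positivity))
    rw [Finset.sum_mul]
    refine Finset.sum_le_sum fun j hj => ?_
    rw [← mul_sub, abs_mul, hlin]
    refine mul_le_mul_of_nonneg_left ((hB _ _).trans ?_) (abs_nonneg _)
    gcongr
    calc |t j| ≤ ∑ h, |(θ j).2.2 h * v z h| := Finset.abs_sum_le_sum_abs _ _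
      _ ≤ ∑ _h : Fin d, w * (1 / q) := by
          refine Finset.sum_le_sum fun h _ => ?_
          rw [abs_mul]
          have := hw' j hj h
          have := hv1 z hz h
          gcongr
      _ = d * w / q := by simp; ring
  calc _ ≤ |_ - Φ b z| + |Φ b z - S i z| := abs_sub_le _ _ _
    _ ≤ T * (B * (d * w / q) ^ s) + Fintype.card I * η := add_le_add happ (hi z hz)
    _ = _ := add_comm _ _

/-- The networks with at most `m` nodes and parameters bounded by `T`. -/
def smallNets (d m : ℕ) (T : ℝ) : Set ((Fin d → ℝ) → ℝ) :=
  {g | ∃ (k : ℕ) (J : Finset (Fin k)) (θ : Params d k), J.card ≤ m ∧ |θ.1| ≤ T ∧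
    (∀ j ∈ J, |(θ.2 j).1| ≤ T ∧ |(θ.2 j).2.1| ≤ T ∧ ∀ h, |(θ.2 j).2.2 h| ≤ T) ∧
    g = fun z => θ.1 + ∑ j ∈ J, (θ.2 j).1 *
      Real.sigmoid ((θ.2 j).2.1 + ∑ h, (θ.2 j).2.2 h * z h)}

/-- As `σ` is 1-Lipschitz with values in `[0, 1]`, moving all parameters by at most `η` moves the
intercept by `η` and each node by `η + T (d + 1) η` on the cube. -/
lemma unifCover_smallNets (d m : ℕ) {T η : ℝ} (hT : 0 ≤ T) (hη : 0 < η) :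
    UnifCover (Icc 0 1) (smallNets d m T) (η + m * (η + T * ((d + 1) * η)))
      ((⌊2 * T / η⌋₊ + 1) ^ (m * (d + 2) + 1)) := by
  classical
  set I : Type := Option (Fin m × Option (Option (Fin d))) with hI
  set ψ : (I → ℝ) → Fin m → (Fin d → ℝ) → ℝ := fun b j z =>
    b (some (j, none)) * Real.sigmoid (b (some (j, some none)) +
      ∑ h, b (some (j, some (some h))) * z h) with hψ
  set Φ : (I → ℝ) → (Fin d → ℝ) → ℝ := fun b z => b none + ∑ j, ψ b j z with hΦ
  have hbox := UnifCover.of_box (D := Icc (0 : Fin d → ℝ) 1) (M := T) hη Φ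
    (δ := η + m * (η + T * ((d + 1) * η))) (by
      intro b b' _ hb' hbb z hz
      have e : Φ b z - Φ b' z = (b none - b' none) + ∑ j, (ψ b j z - ψ b' j z) := by
        simp only [hΦ, Finset.sum_sub_distrib]; ring
      rw [e]
      refine (abs_add_le _ _).trans (add_le_add (hbb none) ?_)
      refine (Finset.abs_sum_le_sum_abs _ _).trans ?_
      calc _ ≤ ∑ _j : Fin m, (η + T * ((d + 1) * η)) := by
            refine Finset.sum_le_sum fun j _ => ?_
            simp only [hψ]
            set U := b (some (j, some none)) + ∑ h, b (some (j, some (some h))) * z h with hU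
            set U' := b' (some (j, some none)) + ∑ h, b' (some (j, some (some h))) * z h with hU'
            have e2 : b (some (j, none)) * Real.sigmoid U - b' (some (j, none)) * Real.sigmoid U' =
              (b (some (j, none)) - b' (some (j, none))) * Real.sigmoid U +
                b' (some (j, none)) * (Real.sigmoid U - Real.sigmoid U') := by ring
            have hUU : |U - U'| ≤ (d + 1) * η := by
              have e3 : U - U' = (b (some (j, some none)) - b' (some (j, some none))) +
                  ∑ h, (b (some (j, some (some h))) - b' (some (j, some (some h)))) * z h := by
                simp only [hU, hU', sub_mul, Finset.sum_sub_distrib]; ring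
              rw [e3]
              calc _ ≤ η + ∑ _h : Fin d, η := by
                    refine (abs_add_le _ _).trans (add_le_add (hbb _) ?_)
                    refine (Finset.abs_sum_le_sum_abs _ _).trans (Finset.sum_le_sum fun h _ => ?_)
                    rw [abs_mul]
                    refine (mul_le_mul (hbb _) ?_ (abs_nonneg _) hη.le).trans (mul_one η).le
                    rw [abs_of_nonneg (hz.1 h)]
                    exact hz.2 h
                _ = (d + 1) * η := by simp; ring
            rw [e2]
            refine (abs_add_le _ _).trans (add_le_add ?_ ?_)
            · rw [abs_mul, abs_of_nonneg (Real.sigmoid_nonneg _)]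
              exact (mul_le_mul (hbb _) (Real.sigmoid_le_one _) (Real.sigmoid_nonneg _)
                hη.le).trans (mul_one η).le
            · rw [abs_mul]
              exact mul_le_mul (hb' _) ((abs_sigmoid_sub_le _ _).trans hUU) (abs_nonneg _) hT
        _ = _ := by simp; ring)
  have hcard : Fintype.card I = m * (d + 2) + 1 := by simp [hI]
  rw [hcard] at hbox
  obtain ⟨S, hS⟩ := hbox
  refine ⟨S, ?_⟩
  rintro g ⟨k, J, θ, hJ, h0, hθ, rfl⟩
  refine hS _ ?_
  -- The nodes are relabelled by `Fin m` and padded with zero nodes, whose output weight makes them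
  -- vanish.
  obtain ⟨e⟩ : Nonempty (J ↪ Fin m) := by
    rw [Function.Embedding.nonempty_iff_card_le]
    simpa using hJ
  set Θ : Fin m → ℝ × ℝ × (Fin d → ℝ) := Function.extend e (fun j => θ.2 j) 0 with hΘ
  have hΘe : ∀ j : J, Θ (e j) = θ.2 j := fun j => e.injective.extend_apply _ _ _
  have hΘ0 : ∀ i, (¬ ∃ j, e j = i) → Θ i = 0 := fun i hi => by
    simp [hΘ, Function.extend_apply' _ _ _ hi]
  have hΘT : ∀ i, |(Θ i).1| ≤ T ∧ |(Θ i).2.1| ≤ T ∧ ∀ h, |(Θ i).2.2 h| ≤ T := by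
    intro i
    by_cases hi : ∃ j, e j = i
    · obtain ⟨j, rfl⟩ := hi
      rw [hΘe]
      exact hθ j j.2
    · simp [hΘ0 i hi, hT]
  refine ⟨fun x => match x with
    | none => θ.1
    | some (j, none) => (Θ j).1
    | some (j, some none) => (Θ j).2.1
    | some (j, some (some h)) => (Θ j).2.2 h, ?_, ?_⟩
  · rintro (_ | ⟨j, _ | _ | h⟩)
    · exact h0
    · exact (hΘT j).1
    · exact (hΘT j).2.1
    · exact (hΘT j).2.2 h
  · funext z
    simp only [hΦ, hψ]
    congr 1
    rw [← Finset.sum_coe_sort J]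
    simp only [← hΘe]
    rw [← Finset.sum_map Finset.univ e (fun i => (Θ i).1 *
      Real.sigmoid ((Θ i).2.1 + ∑ h, (Θ i).2.2 h * z h))]
    refine Finset.sum_subset (Finset.subset_univ _) fun i _ hi => ?_
    rw [hΘ0 i (by simpa using hi)]
    simp

end BNN

/-! ### Sublinear entropy under a bound on the parameter norm -/

namespace BNN

/-- The squared Euclidean norm of the parameters. -/
def energy {d k : ℕ} (θ : Params d k) : ℝ :=
  θ.1 ^ 2 + ∑ j, ((θ.2 j).1 ^ 2 + ((θ.2 j).2.1 ^ 2 + ∑ h, (θ.2 j).2.2 h ^ 2))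

lemma sq_intercept_le_energy {d k : ℕ} (θ : Params d k) : θ.1 ^ 2 ≤ energy θ :=
  le_add_of_nonneg_right (Finset.sum_nonneg fun j _ => by positivity)

lemma sum_node_le_energy {d k : ℕ} (θ : Params d k) (J : Finset (Fin k)) :
    ∑ j ∈ J, ((θ.2 j).1 ^ 2 + ((θ.2 j).2.1 ^ 2 + ∑ h, (θ.2 j).2.2 h ^ 2)) ≤ energy θ :=
  (Finset.sum_le_sum_of_subset_of_nonneg (Finset.subset_univ J)
    fun _ _ _ => by positivity).trans (le_add_of_nonneg_left (sq_nonneg _))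

lemma node_le_energy {d k : ℕ} (θ : Params d k) (j : Fin k) :
    (θ.2 j).1 ^ 2 + ((θ.2 j).2.1 ^ 2 + ∑ h, (θ.2 j).2.2 h ^ 2) ≤ energy θ := by
  simpa using sum_node_le_energy θ {j}

lemma sq_weight_le {d : ℕ} (x : Fin d → ℝ) (h : Fin d) : x h ^ 2 ≤ ∑ h, x h ^ 2 :=
  Finset.single_le_sum (f := fun h => x h ^ 2) (fun _ _ => sq_nonneg _) (Finset.mem_univ h)

/-- The networks with at most `n` nodes and squared parameter norm at most `E`. -/
def energyNets (d n : ℕ) (E : ℝ) : Set ((Fin d → ℝ) → ℝ) :=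
  {g | ∃ k ≤ n, ∃ θ : Params d k, energy θ ≤ E ∧ g = net θ}

/-- Each node with an input weight above `w` uses more than `w²` of the energy, so there are at most
`E / w²` of them. The remaining nodes are flat, with output weights at most `T` each. -/
lemma exists_small_add_flat {d n : ℕ} {E T w : ℝ} (hw : 0 < w) (hT : 0 ≤ T) (hE : E ≤ T ^ 2)
    {g : (Fin d → ℝ) → ℝ} (hg : g ∈ energyNets d n E) :
    ∃ b ∈ smallNets d ⌊E / w ^ 2⌋₊ T, ∃ c ∈ flatNets d w (n * T), ∀ z, g z = b z + c z := by
  classical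
  obtain ⟨k, hk, θ, hθ, rfl⟩ := hg
  have hsq : ∀ x : ℝ, x ^ 2 ≤ energy θ → |x| ≤ T := fun x hx =>
    abs_le_of_sq_le_sq (hx.trans (hθ.trans hE)) hT
  have hT1 : ∀ j, |(θ.2 j).1| ≤ T := fun j => hsq _ (by
    have := node_le_energy θ j
    have : 0 ≤ (θ.2 j).2.1 ^ 2 + ∑ h, (θ.2 j).2.2 h ^ 2 := by positivity
    linarith)
  have hT2 : ∀ j, |(θ.2 j).2.1| ≤ T := fun j => hsq _ (by
    have := node_le_energy θ j
    have : 0 ≤ (θ.2 j).1 ^ 2 + ∑ h, (θ.2 j).2.2 h ^ 2 := by positivity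
    linarith)
  have hT3 : ∀ j h, |(θ.2 j).2.2 h| ≤ T := fun j h => hsq _ (by
    have := node_le_energy θ j
    have := sq_weight_le (θ.2 j).2.2 h
    have : 0 ≤ (θ.2 j).1 ^ 2 + (θ.2 j).2.1 ^ 2 := by positivity
    linarith)
  set J : Finset (Fin k) := Finset.univ.filter fun j => ∃ h, w < |(θ.2 j).2.2 h| with hJ
  have hJcard : J.card ≤ ⌊E / w ^ 2⌋₊ := by
    refine Nat.le_floor ?_
    rw [le_div_iff₀ (by positivity)]
    refine le_trans ?_ ((sum_node_le_energy θ J).trans hθ)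
    rw [← nsmul_eq_mul]
    refine Finset.card_nsmul_le_sum _ _ _ fun j hj => ?_
    obtain ⟨h, hh⟩ := (Finset.mem_filter.1 hj).2
    have h1 := sq_weight_le (θ.2 j).2.2 h
    have h2 : w ^ 2 ≤ (θ.2 j).2.2 h ^ 2 := by
      rw [← sq_abs ((θ.2 j).2.2 h)]
      gcongr
    have : 0 ≤ (θ.2 j).1 ^ 2 + (θ.2 j).2.1 ^ 2 := by positivity
    linarith
  refine ⟨_, ⟨k, J, θ, hJcard, hsq _ (sq_intercept_le_energy θ),
    fun j _ => ⟨hT1 j, hT2 j, hT3 j⟩, rfl⟩, _, ⟨k, Jᶜ, θ.2, ?_, ?_, rfl⟩, ?_⟩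
  · intro j hj h
    simp only [hJ, Finset.mem_compl, Finset.mem_filter, Finset.mem_univ, true_and, not_exists,
      not_lt] at hj
    exact hj h
  · calc _ ≤ ∑ _j ∈ Jᶜ, T := Finset.sum_le_sum fun j _ => hT1 j
      _ ≤ n * T := by
        rw [Finset.sum_const, nsmul_eq_mul]
        refine mul_le_mul_of_nonneg_right ?_ hT
        exact_mod_cast (Finset.card_le_univ _).trans (by simpa using hk)
  · intro z
    simp only [net]
    rw [add_assoc, Finset.sum_add_sum_compl]

/-- The number of grid points per coordinate is polynomial in `n`, hence in `w`, hence at most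
exponential in `w`. Each rounded coordinate thus costs entropy `O(w)`. -/
lemma natFloor_succ_le_exp {x C : ℝ} {n w e J : ℕ} (hx : 0 ≤ x) (hC : 0 ≤ C) (hw : 1 ≤ w)
    (hn : 1 ≤ n) (hnw : (n : ℝ) ≤ (2 * w) ^ e) (h : x ≤ C * n ^ J) :
    ((⌊x⌋₊ + 1 : ℕ) : ℝ) ≤ Real.exp ((C + 1 + 2 * (e * J)) * w) := by
  have hw' : (1 : ℝ) ≤ w := by exact_mod_cast hw
  have hn' : (1 : ℝ) ≤ n := by exact_mod_cast hn
  push_cast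
  calc (⌊x⌋₊ : ℝ) + 1 ≤ C * n ^ J + 1 * n ^ J := by
        refine add_le_add ((Nat.floor_le hx).trans h) ?_
        rw [one_mul]; exact one_le_pow₀ hn'
    _ = (C + 1) * n ^ J := by ring
    _ ≤ Real.exp ((C + 1) * w) * (Real.exp (2 * w) ^ e) ^ J := by
        gcongr
        · have h1 := Real.add_one_le_exp ((C + 1) * w)
          nlinarith
        · refine hnw.trans ?_
          gcongr
          linarith [Real.add_one_le_exp (2 * (w : ℝ))]
    _ = _ := by
        rw [← pow_mul, ← Real.exp_nat_mul, ← Real.exp_add]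
        congr 1
        push_cast
        ring

lemma pow_le_exp_of_le {K M : ℕ} {a b : ℝ} (hK : (K : ℝ) ≤ Real.exp a) (ha : 0 ≤ a)
    (hM : (M : ℝ) ≤ b) : ((K ^ M : ℕ) : ℝ) ≤ Real.exp (a * b) := by
  push_cast
  calc (K : ℝ) ^ M ≤ Real.exp a ^ M := by gcongr
    _ = Real.exp (a * M) := by rw [← Real.exp_nat_mul, mul_comm]
    _ ≤ _ := by gcongr

/-- The few steep nodes have `O(n / w²)` parameters and the flat part `O(w ^ (2 d))` coefficients,
each of cost `O(w)`. The radius `δ` is shared among steep parameters, rounded coefficients and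
Taylor remainder. -/
lemma exists_unifCover_energyNets_aux (d : ℕ) {R δ : ℝ} (hR : 0 ≤ R) (hδ : 0 < δ) :
    ∃ C W : ℝ, 0 ≤ C ∧ ∀ n w : ℕ, W ≤ w → 1 ≤ w → w ^ (4 * (d + 1)) ≤ n →
      n ≤ (2 * w) ^ (4 * (d + 1)) →
      ∃ N : ℕ, (N : ℝ) ≤ Real.exp (C * (n / w)) ∧
        UnifCover (Icc 0 1) (energyNets d n (R * n)) δ N := by
  -- `n` is comparable to `w ^ e`. As `e ≥ 2 d + 2`, the entropy `w ^ (2 d + 1)` of the flat part is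
  -- at most `n / w`; as `s = 2 e + 1`, the Taylor error of order `n² / w ^ s` is `O(1 / w)`.
  set e := 4 * (d + 1) with he
  set s := 2 * e + 1 with hs
  obtain ⟨D, B, hB, hcov⟩ := exists_unifCover_flatNets d s
  set η₁ : ℝ := δ / (3 * (D + 1)) with hη₁
  have hη₁' : 0 < η₁ := by positivity
  set C₁ : ℝ := 2 * (R + 1) * B / η₁ with hC₁
  set C₂ : ℝ := 6 * (R + 1) * (1 + R * (1 + (R + 1) * (d + 1))) / δ with hC₂
  have hC₁' : 0 ≤ C₁ := by positivity
  have hC₂' : 0 ≤ C₂ := by positivity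
  set a₁ : ℝ := C₁ + 1 + 2 * (e * (s + 2 : ℕ)) with ha₁
  set a₂ : ℝ := C₂ + 1 + 2 * (e * (3 : ℕ)) with ha₂
  have ha₁' : 0 ≤ a₁ := by positivity
  have ha₂' : 0 ≤ a₂ := by positivity
  refine ⟨a₂ * (R * (d + 2) + 1) + a₁ * (2 ^ d * D), 3 * ((R + 1) * B * d ^ s * 4 ^ e) / δ,
    by positivity, fun n w hW hw hwn hnw => ?_⟩
  have hw' : (1 : ℝ) ≤ w := by exact_mod_cast hw
  have hw0 : (0 : ℝ) < w := by linarith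
  have hnw' : (n : ℝ) ≤ (2 * w) ^ e := by exact_mod_cast hnw
  have hwn' : (w : ℝ) ^ e ≤ n := by exact_mod_cast hwn
  have hn' : (1 : ℝ) ≤ n := (one_le_pow₀ hw').trans hwn'
  have hn : 1 ≤ n := by exact_mod_cast hn'
  have hn0 : (0 : ℝ) < n := by linarith
  have hwlen : (w : ℝ) ≤ n := (le_self_pow₀ hw' (by omega)).trans hwn'
  have hw2n : (w : ℝ) ^ 2 ≤ n := (pow_le_pow_right₀ hw' (by omega)).trans hwn'
  set T : ℝ := (R + 1) * n with hT
  have hT0 : 0 ≤ T := by positivity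
  have hET : R * n ≤ T ^ 2 := by
    have h1 : R * n ≤ T := by rw [hT]; nlinarith
    have h2 : 1 ≤ T := by rw [hT]; nlinarith
    nlinarith
  set m : ℕ := ⌊R * n / w ^ 2⌋₊ with hm
  have hm' : (m : ℝ) ≤ R * n / w ^ 2 := Nat.floor_le (by positivity)
  have hmn : (m : ℝ) ≤ R * n := hm'.trans (div_le_self (by positivity) (one_le_pow₀ hw'))
  set η₂ : ℝ := δ / (3 * (1 + R * n * (1 + T * (d + 1)))) with hη₂
  have hη₂' : 0 < η₂ := by positivity
  -- Weights at most `w` on cells of side `w⁻²` give Taylor increments of at most `d / w`.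
  have hflat := hcov (w ^ 2) w (n * T) η₁ (by positivity) hw' (by positivity) hη₁'
  have hsmall := unifCover_smallNets d m hT0 hη₂'
  have hall := UnifCover.add (A := energyNets d n (R * n)) (δ₃ := 0) hsmall hflat (by
    intro g hg
    obtain ⟨b, hb, c, hc, h⟩ := exists_small_add_flat hw0 hT0 hET hg
    exact ⟨b, hb, c, hc, fun z _ => by simp [h z]⟩)
  refine ⟨_, ?_, hall.mono ?_⟩
  · rw [Nat.cast_mul]
    have h2 : (((⌊2 * T / η₂⌋₊ + 1) ^ (m * (d + 2) + 1) : ℕ) : ℝ) ≤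
        Real.exp ((a₂ * w) * ((R * (d + 2) + 1) * (n / w ^ 2))) := by
      refine pow_le_exp_of_le (natFloor_succ_le_exp (by positivity) hC₂' hw hn hnw' ?_)
        (by positivity) ?_
      · have e1 : 2 * T / η₂ = 6 * (R + 1) * (n * (1 + R * n * (1 + (R + 1) * n * (d + 1)))) / δ := by
          rw [hη₂, hT]; field_simp; ring
        rw [e1, hC₂, div_mul_eq_mul_div]
        refine div_le_div_of_nonneg_right ?_ hδ.le
        rw [mul_assoc (6 * (R + 1))]
        refine mul_le_mul_of_nonneg_left ?_ (by positivity)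
        have h1 : (n : ℝ) ≤ n ^ 3 := le_self_pow₀ hn' (by norm_num)
        have h2 : (n : ℝ) ^ 2 ≤ n ^ 3 := pow_le_pow_right₀ hn' (by norm_num)
        calc (n : ℝ) * (1 + R * n * (1 + (R + 1) * n * (d + 1)))
            = n + R * n ^ 2 + R * ((R + 1) * (d + 1)) * n ^ 3 := by ring
          _ ≤ n ^ 3 + R * n ^ 3 + R * ((R + 1) * (d + 1)) * n ^ 3 := by gcongr
          _ = _ := by ring
      · push_cast
        have h1 : (1 : ℝ) ≤ n / w ^ 2 := (one_le_div (by positivity)).2 hw2n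
        calc (m : ℝ) * (d + 2) + 1 ≤ (R * n / w ^ 2) * (d + 2) + n / w ^ 2 := by gcongr
          _ = _ := by ring
    have h1 : (((⌊2 * (n * T * (B * w ^ s)) / η₁⌋₊ + 1) ^ ((w ^ 2 + 1) ^ d * D) : ℕ) : ℝ) ≤
        Real.exp ((a₁ * w) * (2 ^ d * D * w ^ (2 * d))) := by
      refine pow_le_exp_of_le (natFloor_succ_le_exp (by positivity) hC₁' hw hn hnw' ?_)
        (by positivity) ?_
      · rw [hC₁, hT, div_mul_eq_mul_div]
        refine div_le_div_of_nonneg_right ?_ hη₁'.le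
        calc 2 * (n * ((R + 1) * n) * (B * (w : ℝ) ^ s))
            ≤ 2 * (n * ((R + 1) * n) * (B * (n : ℝ) ^ s)) := by gcongr
          _ = _ := by ring
      · push_cast
        calc ((w : ℝ) ^ 2 + 1) ^ d * D ≤ (2 * w ^ 2) ^ d * D := by
              gcongr
              nlinarith [one_le_pow₀ hw' (n := 2)]
          _ = _ := by rw [mul_pow, ← pow_mul]; ring
    refine (mul_le_mul h2 h1 (Nat.cast_nonneg _) (Real.exp_pos _).le).trans ?_
    rw [← Real.exp_add, Real.exp_le_exp]
    have e2 : a₂ * w * ((R * (d + 2) + 1) * (n / w ^ 2)) = a₂ * (R * (d + 2) + 1) * (n / w) := by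
      field_simp
    have e1 : a₁ * w * (2 ^ d * D * w ^ (2 * d)) ≤ a₁ * (2 ^ d * D) * (n / w) := by
      have : (w : ℝ) ^ (2 * d + 1) ≤ n / w := by
        rw [le_div_iff₀ hw0, ← pow_succ]
        exact (pow_le_pow_right₀ hw' (by omega)).trans hwn'
      calc _ = a₁ * (2 ^ d * D) * (w : ℝ) ^ (2 * d + 1) := by ring
        _ ≤ _ := by gcongr
    rw [e2, add_mul]
    linarith
  · have h2 : η₂ + m * (η₂ + T * ((d + 1) * η₂)) ≤ δ / 3 := by
      calc η₂ + m * (η₂ + T * ((d + 1) * η₂)) ≤ η₂ + R * n * (η₂ + T * ((d + 1) * η₂)) := by gcongr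
        _ = η₂ * (1 + R * n * (1 + T * (d + 1))) := by ring
        _ = δ / 3 := by rw [hη₂]; field_simp
    have h1 : D * η₁ ≤ δ / 3 := by
      calc D * η₁ ≤ (D + 1) * η₁ := by gcongr; linarith
        _ = δ / 3 := by rw [hη₁]; field_simp
    have h3 : n * T * (B * (d * w / (w ^ 2 : ℕ)) ^ s) ≤ δ / 3 := by
      rw [div_le_iff₀ hδ] at hW
      have e1 : (d : ℝ) * w / (w ^ 2 : ℕ) = d / w := by
        push_cast; field_simp
      have hn2 : (n : ℝ) ^ 2 ≤ (4 : ℝ) ^ e * (w : ℝ) ^ (2 * e) := by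
        calc (n : ℝ) ^ 2 ≤ ((2 * (w : ℝ)) ^ e) ^ 2 := by gcongr
          _ = (4 : ℝ) ^ e * (w : ℝ) ^ (2 * e) := by
            rw [mul_pow, mul_pow, ← pow_mul, ← pow_mul, mul_comm e 2, pow_mul]; norm_num
      rw [e1, div_pow]
      calc n * T * (B * ((d : ℝ) ^ s / w ^ s)) = (R + 1) * B * d ^ s * n ^ 2 / w ^ s := by
            rw [hT]; ring
        _ ≤ (R + 1) * B * d ^ s * (4 ^ e * w ^ (2 * e)) / w ^ s := by gcongr
        _ = (R + 1) * B * d ^ s * 4 ^ e / w := by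
            rw [hs, pow_succ (w : ℝ)]; field_simp
        _ ≤ δ / 3 := by
            rw [div_le_iff₀ hw0]; linarith
    linarith

/-- The metric entropy of the networks with at most `n` nodes and squared parameter norm at most
`R n` is of smaller order than `n`. -/
theorem eventually_exists_unifCover_energyNets (d : ℕ) {R δ η : ℝ} (hR : 0 ≤ R) (hδ : 0 < δ)
    (hη : 0 < η) : ∀ᶠ n : ℕ in atTop, ∃ N : ℕ, (N : ℝ) ≤ Real.exp (n * η) ∧
      UnifCover (Icc 0 1) (energyNets d n (R * n)) δ N := by
  obtain ⟨C, W, hC, h⟩ := exists_unifCover_energyNets_aux d hR hδ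
  set e := 4 * (d + 1) with he
  obtain ⟨w₀, hw₀⟩ := exists_nat_ge (max W (max 1 (C / η)))
  simp only [max_le_iff] at hw₀
  obtain ⟨hw1, hw2, hw3⟩ := hw₀
  have hw2' : 1 ≤ w₀ := by exact_mod_cast hw2
  filter_upwards [eventually_ge_atTop (w₀ ^ e)] with n hn
  -- The largest `w` with `w ^ e ≤ n`; then `n ≤ (w + 1) ^ e ≤ (2 w) ^ e` because `w ≥ 1`.
  set w := Nat.findGreatest (fun w => w ^ e ≤ n) n with hw
  have hself : ∀ x : ℕ, x ≤ x ^ e := fun x => Nat.le_self_pow (by omega) x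
  have hww : w₀ ≤ w := Nat.le_findGreatest ((hself _).trans hn) hn
  have hwn : w ^ e ≤ n := Nat.findGreatest_spec (P := fun w => w ^ e ≤ n) (m := 0) (Nat.zero_le n)
    (by simp [he])
  have hnw : n ≤ (w + 1) ^ e := by
    by_contra hcon
    push Not at hcon
    have := Nat.le_findGreatest (P := fun w => w ^ e ≤ n) ((hself (w + 1)).trans hcon.le) hcon.le
    omega
  have hww' : (w₀ : ℝ) ≤ w := by exact_mod_cast hww
  have hw0 : (0 : ℝ) < w := by linarith
  obtain ⟨N, hN, hcov⟩ := h n w (hw1.trans hww') (hw2'.trans hww) hwn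
    (hnw.trans (Nat.pow_le_pow_left (by omega) e))
  refine ⟨N, hN.trans (Real.exp_le_exp.2 ?_), hcov⟩
  have : C / w ≤ η := by
    rw [div_le_iff₀ hη] at hw3
    rw [div_le_iff₀ hw0]
    nlinarith
  calc C * (n / w) = n * (C / w) := by ring
    _ ≤ n * η := by gcongr

end BNN

/-! ### Measurability on disjoint unions; products of independent copies -/

lemma measurableEmbedding_sigmaMk {ι : Type*} {α : ι → Type*} [∀ i, MeasurableSpace (α i)]
    (i : ι) : MeasurableEmbedding (Sigma.mk i : α i → Σ i, α i) where
  injective := sigma_mk_injective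
  measurable := measurable_iff_comap_le.2 <| MeasurableSpace.comap_le_iff_le_map.2 <| iInf_le _ i
  measurableSet_image' := by
    intro s hs
    refine MeasurableSpace.measurableSet_iInf.2 fun j => ?_
    change MeasurableSet (Sigma.mk j ⁻¹' (Sigma.mk i '' s))
    by_cases h : j = i
    · subst h
      rwa [preimage_image_eq _ sigma_mk_injective]
    · convert MeasurableSet.empty
      ext x
      simp only [mem_preimage, mem_image, mem_empty_iff_false, iff_false, not_exists, not_and]
      intro y _ hy
      exact h (congrArg Sigma.fst hy).symm

lemma measurable_sigma_prod {ι : Type*} [Countable ι] {α : ι → Type*}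
    [∀ i, MeasurableSpace (α i)] {β γ : Type*} [MeasurableSpace β] [MeasurableSpace γ]
    {f : (Σ i, α i) × β → γ} (h : ∀ i, Measurable fun q : α i × β => f (⟨i, q.1⟩, q.2)) :
    Measurable f := by
  intro s hs
  have e : f ⁻¹' s = ⋃ i, Prod.map (Sigma.mk i) id ''
      ((fun q : α i × β => f (⟨i, q.1⟩, q.2)) ⁻¹' s) := by
    ext ⟨⟨i, x⟩, y⟩
    simp only [mem_preimage, mem_iUnion, mem_image, Prod.exists, Prod.map_apply, id]
    constructor
    · intro hx
      exact ⟨i, x, y, hx, rfl⟩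
    · rintro ⟨j, x', y', hx, he⟩
      rwa [he] at hx
  rw [e]
  exact MeasurableSet.iUnion fun i =>
    ((measurableEmbedding_sigmaMk i).prodMap MeasurableEmbedding.id).measurableSet_image.2 (h i hs)

lemma measurable_sigma {ι : Type*} {α : ι → Type*} [∀ i, MeasurableSpace (α i)] {γ : Type*}
    [MeasurableSpace γ] {f : (Σ i, α i) → γ} (h : ∀ i, Measurable fun q : α i => f ⟨i, q⟩) :
    Measurable f := fun _ hs => MeasurableSpace.measurableSet_iInf.2 fun i => h i hs

/-- The integral of a product of a function over independent copies of a variable. -/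
lemma lintegral_pi_prod {ι E : Type*} [Fintype ι] [MeasurableSpace E]
    (μ : Measure E) [IsProbabilityMeasure μ] {f : E → ℝ≥0∞} (hf : Measurable f) :
    ∫⁻ x : ι → E, ∏ i, f (x i) ∂Measure.pi (fun _ => μ) = (∫⁻ x, f x ∂μ) ^ Fintype.card ι := by
  have h := lintegral_prod_eq_prod_lintegral_of_indepFun (μ := Measure.pi fun _ : ι => μ)
    Finset.univ (fun i (x : ι → E) => f (x i))
    (iIndepFun_pi (X := fun _ => f) fun i => hf.aemeasurable)
    fun i => hf.comp (measurable_pi_apply i)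
  refine h.trans ?_
  have h1 : ∀ i : ι, ∫⁻ x : ι → E, f (x i) ∂Measure.pi (fun _ => μ) = ∫⁻ x, f x ∂μ := fun i =>
    (measurePreserving_eval (fun _ : ι => μ) i).lintegral_comp hf
  simp [h1]

/-! ### The prior: measurability and tail bounds -/

namespace BNN

instance (d : ℕ) : IsProbabilityMeasure (cubeUniform d) := by
  refine ⟨?_⟩
  rw [cubeUniform, Measure.restrict_apply_univ, Real.volume_Icc_pi]
  simp

instance (d k : ℕ) (τ : ℝ≥0) : IsProbabilityMeasure (paramPrior d k τ) := by
  unfold paramPrior; infer_instance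

instance (d : ℕ) : SigmaFinite (refMeasure d) := by
  unfold refMeasure; infer_instance

lemma measurable_net (d k : ℕ) :
    Measurable fun q : Params d k × (Fin d → ℝ) => net q.1 q.2 := by
  unfold net
  have := continuous_sigmoid
  fun_prop

lemma measurable_modelDensity (d : ℕ) :
    Measurable fun q : FullParams d × ((Fin d → ℝ) × ℝ) => modelDensity q.1.2 q.2 := by
  refine measurable_sigma_prod fun k => ?_
  unfold modelDensity gaussianPDFReal
  have h : Measurable fun q : Params d k × ((Fin d → ℝ) × ℝ) => net q.1 q.2.1 :=
    (measurable_net d k).comp (measurable_fst.prodMk (measurable_fst.comp measurable_snd))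
  exact (((((measurable_snd.comp measurable_snd).sub h).pow_const 2).neg.div_const _).exp).const_mul _

lemma measurable_net_right {d k : ℕ} (θ : Params d k) : Measurable (net θ) :=
  (measurable_net d k).comp measurable_prodMk_left

lemma measurable_modelDensity_right {d k : ℕ} (θ : Params d k) : Measurable (modelDensity θ) := by
  unfold modelDensity gaussianPDFReal
  have h : Measurable fun x : (Fin d → ℝ) × ℝ => net θ x.1 :=
    (measurable_net_right θ).comp measurable_fst
  exact ((((measurable_snd.sub h).pow_const 2).neg.div_const _).exp).const_mul _

lemma modelDensity_pos {d k : ℕ} (θ : Params d k) (x : (Fin d → ℝ) × ℝ) :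
    0 < modelDensity θ x := gaussianPDFReal_pos _ _ _ one_ne_zero

lemma measurable_energy (d k : ℕ) : Measurable fun θ : Params d k => energy θ := by
  unfold energy
  fun_prop

lemma measurableSet_hellingerNhd {d : ℕ} {f₀ : (Fin d → ℝ) × ℝ → ℝ} (hf₀ : Measurable f₀)
    (ε : ℝ) : MeasurableSet (hellingerNhd f₀ ε) := by
  refine measurableSet_le (Measurable.sqrt ?_) measurable_const
  have h : Measurable fun q : FullParams d × ((Fin d → ℝ) × ℝ) =>
      (√(modelDensity q.1.2 q.2) - √(f₀ q.2)) ^ 2 :=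
    (((measurable_modelDensity d).sqrt).sub ((hf₀.comp measurable_snd).sqrt)).pow_const 2
  exact (h.stronglyMeasurable.integral_prod_right' (ν := refMeasure d)).measurable

lemma prior_apply (d : ℕ) (p : unitInterval) (τ : ℝ≥0) {A : Set (FullParams d)}
    (hA : MeasurableSet A) :
    prior d p τ A = ∫⁻ k, paramPrior d k τ (Sigma.mk k ⁻¹' A) ∂geometricMeasure p := by
  rw [prior, Measure.sum_apply _ hA, lintegral_countable']
  refine tsum_congr fun k => ?_
  rw [Measure.smul_apply, Measure.map_apply (measurableEmbedding_sigmaMk k).measurable hA,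
    nodeProb, ofReal_measureReal, smul_eq_mul, mul_comm]

instance (d : ℕ) (p : unitInterval) (τ : ℝ≥0) : IsProbabilityMeasure (prior d p τ) := by
  refine ⟨?_⟩
  rw [prior_apply d p τ MeasurableSet.univ]
  simp

lemma mul_paramPrior_le_prior (d k : ℕ) (p : unitInterval) (τ : ℝ≥0) (A : Set (FullParams d)) :
    ENNReal.ofReal (nodeProb p k) * paramPrior d k τ (Sigma.mk k ⁻¹' A) ≤ prior d p τ A := by
  refine le_trans ?_ (Measure.le_sum (fun k => ENNReal.ofReal (nodeProb p k) •
    (paramPrior d k τ).map (Sigma.mk k)) k A)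
  rw [Measure.smul_apply, smul_eq_mul]
  gcongr
  exact Measure.le_map_apply (measurableEmbedding_sigmaMk k).measurable.aemeasurable A

lemma lintegral_prod_paramPrior (d k : ℕ) (τ : ℝ≥0) {φ : ℝ → ℝ≥0∞} (hφ : Measurable φ) :
    ∫⁻ θ, φ θ.1 * ∏ j, (φ (θ.2 j).1 * (φ (θ.2 j).2.1 * ∏ h, φ ((θ.2 j).2.2 h)))
      ∂paramPrior d k τ = (∫⁻ x, φ x ∂gaussianReal 0 (τ ^ 2)) ^ (1 + k * (d + 2)) := by
  unfold paramPrior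
  have h1 := lintegral_pi_prod (ι := Fin d) (gaussianReal 0 (τ ^ 2)) hφ
  have hm1 : Measurable fun a : Fin d → ℝ => ∏ h, φ (a h) := by fun_prop
  have h2 := lintegral_prod_mul (μ := gaussianReal 0 (τ ^ 2)) (ν := Measure.pi fun _ : Fin d =>
    gaussianReal 0 (τ ^ 2)) hφ.aemeasurable hm1.aemeasurable
  have hm2 : Measurable fun q : ℝ × (Fin d → ℝ) => φ q.1 * ∏ h, φ (q.2 h) := by fun_prop
  have h3 := lintegral_prod_mul (μ := gaussianReal 0 (τ ^ 2)) (ν := (gaussianReal 0 (τ ^ 2)).prod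
    (Measure.pi fun _ : Fin d => gaussianReal 0 (τ ^ 2))) hφ.aemeasurable hm2.aemeasurable
  have hm3 : Measurable fun q : ℝ × ℝ × (Fin d → ℝ) => φ q.1 * (φ q.2.1 * ∏ h, φ (q.2.2 h)) := by
    fun_prop
  have h4 := lintegral_pi_prod (ι := Fin k) ((gaussianReal 0 (τ ^ 2)).prod
    ((gaussianReal 0 (τ ^ 2)).prod (Measure.pi fun _ : Fin d => gaussianReal 0 (τ ^ 2)))) hm3
  have hm4 : Measurable fun q : Fin k → ℝ × ℝ × (Fin d → ℝ) =>
      ∏ j, (φ (q j).1 * (φ (q j).2.1 * ∏ h, φ ((q j).2.2 h))) := by fun_prop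
  rw [lintegral_prod_mul hφ.aemeasurable hm4.aemeasurable, h4, h3, h2, h1]
  simp only [Fintype.card_fin]
  ring

/-- The energy is a sum over `1 + k (d + 2)` independent, identically distributed parameters, so its
exponential moment factors. -/
lemma lintegral_exp_energy (d k : ℕ) (τ : ℝ≥0) (t : ℝ) :
    ∫⁻ θ, ENNReal.ofReal (Real.exp (t * energy θ)) ∂paramPrior d k τ =
      (∫⁻ x, ENNReal.ofReal (Real.exp (t * x ^ 2)) ∂gaussianReal 0 (τ ^ 2)) ^
        (1 + k * (d + 2)) := by
  rw [← lintegral_prod_paramPrior d k τ (by fun_prop)]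
  refine lintegral_congr fun θ => ?_
  simp only [energy, mul_add, Finset.mul_sum, Real.exp_add, Real.exp_sum,
    ENNReal.ofReal_mul (Real.exp_pos _).le]
  rw [ENNReal.ofReal_prod_of_nonneg fun j _ => by positivity]
  congr 1
  refine Finset.prod_congr rfl fun j _ => ?_
  rw [ENNReal.ofReal_mul (Real.exp_pos _).le, ENNReal.ofReal_mul (Real.exp_pos _).le,
    ENNReal.ofReal_prod_of_nonneg fun h _ => by positivity]

/-- The prior probability that the squared parameter norm exceeds a large multiple of `n` is
exponentially small, uniformly over networks with at most `n` nodes. -/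
lemma exists_paramPrior_energy_le (d : ℕ) (τ : ℝ≥0) : ∃ R : ℝ, 0 ≤ R ∧ ∀ n k : ℕ, 1 ≤ n → k ≤ n →
    paramPrior d k τ {θ | R * n < energy θ} ≤ ENNReal.ofReal (Real.exp (-n)) := by
  -- Fernique's theorem gives the exponential moment for a Chernoff bound. At most `n (d + 3)`
  -- parameters contribute `L` each to the exponent, so `R` below leaves exactly `-n`.
  obtain ⟨t, ht, hint⟩ := IsGaussian.exists_integrable_exp_sq (gaussianReal 0 (τ ^ 2))
  simp only [Real.norm_eq_abs, sq_abs] at hint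
  set M := ∫⁻ x, ENNReal.ofReal (Real.exp (t * x ^ 2)) ∂gaussianReal 0 (τ ^ 2) with hM
  have hMr : M = ENNReal.ofReal (∫ x, Real.exp (t * x ^ 2) ∂gaussianReal 0 (τ ^ 2)) :=
    (ofReal_integral_eq_lintegral_ofReal hint (Eventually.of_forall fun _ =>
      (Real.exp_pos _).le)).symm
  obtain ⟨L, hL0, hL⟩ : ∃ L : ℝ, 0 ≤ L ∧ M ≤ ENNReal.ofReal (Real.exp L) := by
    refine ⟨|∫ x, Real.exp (t * x ^ 2) ∂gaussianReal 0 (τ ^ 2)|, abs_nonneg _, ?_⟩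
    rw [hMr]
    refine ENNReal.ofReal_le_ofReal ((le_abs_self _).trans ?_)
    linarith [Real.add_one_le_exp |∫ x, Real.exp (t * x ^ 2) ∂gaussianReal 0 (τ ^ 2)|]
  refine ⟨((d + 3) * L + 1) / t, by positivity, fun n k hn hk => ?_⟩
  set R := ((d + 3) * L + 1) / t with hR
  have hRt : t * R = (d + 3) * L + 1 := by rw [hR]; field_simp
  have h1 : paramPrior d k τ {θ | R * n < energy θ} ≤
      (∫⁻ θ, ENNReal.ofReal (Real.exp (t * energy θ)) ∂paramPrior d k τ) /
        ENNReal.ofReal (Real.exp (t * (R * n))) := by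
    refine le_trans (measure_mono ?_) (meas_ge_le_lintegral_div
      (((measurable_energy d k).const_mul t).exp.ennreal_ofReal).aemeasurable
      (by simp [Real.exp_pos]) ENNReal.ofReal_ne_top)
    intro θ hθ
    refine ENNReal.ofReal_le_ofReal (Real.exp_le_exp.2 ?_)
    exact mul_le_mul_of_nonneg_left (le_of_lt hθ) ht.le
  refine h1.trans ?_
  rw [lintegral_exp_energy, ← hM]
  calc M ^ (1 + k * (d + 2)) / ENNReal.ofReal (Real.exp (t * (R * n)))
      ≤ ENNReal.ofReal (Real.exp L) ^ (1 + k * (d + 2)) /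
          ENNReal.ofReal (Real.exp (t * (R * n))) := by gcongr
    _ = ENNReal.ofReal (Real.exp ((1 + k * (d + 2) : ℕ) * L - t * (R * n))) := by
        rw [← ENNReal.ofReal_pow (Real.exp_pos _).le, ← Real.exp_nat_mul,
          ← ENNReal.ofReal_div_of_pos (Real.exp_pos _), Real.exp_sub]
    _ ≤ _ := by
        refine ENNReal.ofReal_le_ofReal (Real.exp_le_exp.2 ?_)
        rw [← mul_assoc, hRt]
        have h2 : ((1 + k * (d + 2) : ℕ) : ℝ) ≤ n * (d + 3) := by
          have : 1 + k * (d + 2) ≤ n * (d + 3) := by nlinarith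
          exact_mod_cast this
        nlinarith

lemma geometricMeasure_Ioi {p : unitInterval} (hp : 0 < p) (n : ℕ) :
    geometricMeasure p (Ioi n) = ENNReal.ofReal ((1 - p) ^ (n + 1)) := by
  have e : Ioi n = ((Finset.range (n + 1) : Finset ℕ) : Set ℕ)ᶜ := by
    ext k; simp
  rw [← ofReal_measureReal, e, probReal_compl_eq_one_sub (Finset.measurableSet _)]
  congr 1
  rw [← sum_measureReal_singleton]
  simp only [geometricMeasure_real_singleton hp.ne', ← Finset.sum_mul]
  have := geom_sum_mul_neg (1 - (p : ℝ)) (n + 1)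
  rw [sub_sub_cancel] at this
  rw [this]; ring

/-- The networks with at most `n` nodes and squared parameter norm at most `R n`. -/
def energySieve (d : ℕ) (R : ℝ) (n : ℕ) : Set (FullParams d) :=
  {θ | θ.1 ≤ n ∧ energy θ.2 ≤ R * n}

lemma measurableSet_energySieve (d : ℕ) (R : ℝ) (n : ℕ) : MeasurableSet (energySieve d R n) := by
  have h1 : Measurable fun θ : FullParams d => θ.1 := measurable_sigma fun k => measurable_const
  have h2 : Measurable fun θ : FullParams d => energy θ.2 :=
    measurable_sigma fun k => measurable_energy d k
  exact (measurableSet_le h1 measurable_const).inter (measurableSet_le h2 measurable_const)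

lemma exists_prior_compl_energySieve_le (d : ℕ) {p : unitInterval} (hp : 0 < p) (hp1 : p < 1)
    (τ : ℝ≥0) : ∃ R c : ℝ, 0 ≤ R ∧ 0 < c ∧ ∀ᶠ n : ℕ in atTop,
      prior d p τ (energySieve d R n)ᶜ ≤ ENNReal.ofReal (Real.exp (-(n * c))) := by
  obtain ⟨R, hR, h⟩ := exists_paramPrior_energy_le d τ
  have hp' : (0 : ℝ) < p := hp
  have hp1' : (p : ℝ) < 1 := hp1
  have hq0 : 0 < 1 - (p : ℝ) := by linarith
  have hlog : Real.log (1 - p) < 0 := Real.log_neg hq0 (by linarith)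
  -- The smaller of the geometric and Gaussian rates; halving it later absorbs the factor `2` from
  -- adding the two tails.
  set c := min (-Real.log (1 - p)) 1 with hc
  have hc0 : 0 < c := lt_min (by linarith) one_pos
  refine ⟨R, c / 2, hR, by positivity, ?_⟩
  have htend : Tendsto (fun n : ℕ => (n : ℝ) * (c / 2)) atTop atTop :=
    tendsto_natCast_atTop_atTop.atTop_mul_const (by positivity)
  filter_upwards [eventually_ge_atTop 1, htend.eventually_ge_atTop 1] with n hn hn2
  have hn0 : (0 : ℝ) ≤ n := Nat.cast_nonneg n
  rw [prior_apply d p τ (measurableSet_energySieve d R n).compl]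
  calc ∫⁻ k, paramPrior d k τ (Sigma.mk k ⁻¹' (energySieve d R n)ᶜ) ∂geometricMeasure p
      ≤ ∫⁻ k, ((Ioi n).indicator (fun _ => 1) k + ENNReal.ofReal (Real.exp (-n)))
          ∂geometricMeasure p := by
        refine lintegral_mono fun k => ?_
        by_cases hk : k ≤ n
        · refine le_trans (measure_mono ?_) ((h n k hn hk).trans le_add_self)
          intro θ hθ
          by_contra hcon
          exact hθ ⟨hk, not_lt.1 hcon⟩
        · rw [indicator_of_mem (show k ∈ Ioi n from not_le.1 hk)]
          exact prob_le_one.trans le_self_add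
    _ = ENNReal.ofReal ((1 - p) ^ (n + 1)) + ENNReal.ofReal (Real.exp (-n)) := by
        rw [lintegral_add_right _ measurable_const, lintegral_const, measure_univ, mul_one,
          lintegral_indicator measurableSet_Ioi, setLIntegral_one, geometricMeasure_Ioi hp]
    _ ≤ ENNReal.ofReal (Real.exp (-(n * c))) + ENNReal.ofReal (Real.exp (-(n * c))) := by
        refine add_le_add (ENNReal.ofReal_le_ofReal ?_) (ENNReal.ofReal_le_ofReal ?_)
        · calc (1 - (p : ℝ)) ^ (n + 1) ≤ (1 - (p : ℝ)) ^ n :=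
                pow_le_pow_of_le_one hq0.le (by linarith) (Nat.le_succ n)
            _ = Real.exp (n * Real.log (1 - p)) := by
                rw [Real.exp_nat_mul, Real.exp_log hq0]
            _ ≤ _ := by
                refine Real.exp_le_exp.2 ?_
                have : c ≤ -Real.log (1 - p) := min_le_left _ _
                nlinarith
        · refine Real.exp_le_exp.2 ?_
          have : c ≤ 1 := min_le_right _ _
          nlinarith
    _ = ENNReal.ofReal (2 * Real.exp (-(n * c))) := by
        rw [← ENNReal.ofReal_add (Real.exp_pos _).le (Real.exp_pos _).le, two_mul]
    _ ≤ _ := by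
        refine ENNReal.ofReal_le_ofReal ?_
        calc 2 * Real.exp (-(n * c)) ≤ Real.exp (n * (c / 2)) * Real.exp (-(n * c)) := by
              gcongr
              linarith [Real.add_one_le_exp ((n : ℝ) * (c / 2))]
          _ = _ := by rw [← Real.exp_add]; congr 1; ring

end BNN

/-! ### Gaussian envelopes, Hellinger affinity and Kullback-Leibler divergence -/

namespace BNN

/-- An upper bound, proportional to a Gaussian density, for all densities `N(u, 1)` with
`|u - g| ≤ δ`. -/
noncomputable def gaussianEnvelope (δ g y : ℝ) : ℝ :=
  Real.exp (δ / 2) * √((1 - δ)⁻¹) * gaussianPDFReal g (1 - δ)⁻¹.toNNReal y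

lemma gaussianEnvelope_eq {δ : ℝ} (hδ : δ < 1) (g y : ℝ) :
    gaussianEnvelope δ g y =
      (√(2 * Real.pi))⁻¹ * Real.exp (δ / 2 - (1 - δ) * (y - g) ^ 2 / 2) := by
  have h1 : 0 < 1 - δ := by linarith
  have h2 : 0 < (1 - δ)⁻¹ := inv_pos.2 h1
  have h3 : √((1 - δ)⁻¹) ≠ 0 := (Real.sqrt_pos.2 h2).ne'
  rw [gaussianEnvelope, gaussianPDFReal, Real.coe_toNNReal _ h2.le,
    Real.sqrt_mul (by positivity), sub_eq_add_neg (δ / 2), Real.exp_add]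
  have e : -(y - g) ^ 2 / (2 * (1 - δ)⁻¹) = -((1 - δ) * (y - g) ^ 2 / 2) := by
    field_simp
  rw [e]
  field_simp

/-- From `(y - u)² ≥ (y - g)² - 2 δ |y - g|` and `2 |y - g| ≤ (y - g)² + 1`: the shift is paid for
by a larger variance and the factor `exp (δ / 2)`. -/
lemma gaussianPDFReal_le_gaussianEnvelope {δ u g : ℝ} (hδ : δ < 1) (h : |u - g| ≤ δ) (y : ℝ) :
    gaussianPDFReal u 1 y ≤ gaussianEnvelope δ g y := by
  rw [gaussianEnvelope_eq hδ, gaussianPDFReal]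
  simp only [NNReal.coe_one, mul_one]
  gcongr
  have h0 : 0 ≤ δ := (abs_nonneg _).trans h
  have h1 : (y - g) * (u - g) ≤ |y - g| * δ :=
    (le_abs_self _).trans (by rw [abs_mul]; gcongr)
  have h2 : 2 * |y - g| ≤ (y - g) ^ 2 + 1 := by
    nlinarith [sq_abs (y - g), sq_nonneg (|y - g| - 1)]
  nlinarith [sq_nonneg (u - g)]

lemma gaussianEnvelope_nonneg (δ g y : ℝ) : 0 ≤ gaussianEnvelope δ g y :=
  mul_nonneg (by positivity) (gaussianPDFReal_nonneg _ _ _)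

lemma lintegral_gaussianEnvelope {δ : ℝ} (hδ : δ < 1) (g : ℝ) :
    ∫⁻ y, ENNReal.ofReal (gaussianEnvelope δ g y) =
      ENNReal.ofReal (Real.exp (δ / 2) * √((1 - δ)⁻¹)) := by
  have h2 : 0 < (1 - δ)⁻¹ := inv_pos.2 (by linarith)
  unfold gaussianEnvelope
  simp only [ENNReal.ofReal_mul (show 0 ≤ Real.exp (δ / 2) * √((1 - δ)⁻¹) by positivity)]
  rw [lintegral_const_mul _ (measurable_gaussianPDFReal _ _).ennreal_ofReal]
  have := lintegral_gaussianPDFReal_eq_one g (v := (1 - δ)⁻¹.toNNReal)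
    (by simpa using hδ)
  rw [this, mul_one]

lemma lintegral_refMeasure_of_fiber {d : ℕ} {F : (Fin d → ℝ) × ℝ → ℝ} (hF : Measurable F) {c : ℝ}
    (h : ∀ z, ∫⁻ y, ENNReal.ofReal (F (z, y)) = ENNReal.ofReal c) :
    ∫⁻ x, ENNReal.ofReal (F x) ∂refMeasure d = ENNReal.ofReal c := by
  rw [refMeasure, lintegral_prod _ hF.ennreal_ofReal.aemeasurable]
  simp [h]

lemma integrable_and_integral_of_lintegral {α : Type*} [MeasurableSpace α] {μ : Measure α}
    {F : α → ℝ} (hF : Measurable F) (h0 : ∀ x, 0 ≤ F x) {c : ℝ} (hc : 0 ≤ c)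
    (h : ∫⁻ x, ENNReal.ofReal (F x) ∂μ = ENNReal.ofReal c) :
    Integrable F μ ∧ ∫ x, F x ∂μ = c := by
  refine ⟨⟨hF.aestronglyMeasurable, ?_⟩, ?_⟩
  · rw [hasFiniteIntegral_iff_ofReal (Eventually.of_forall h0), h]
    exact ENNReal.ofReal_lt_top
  · rw [integral_eq_lintegral_of_nonneg_ae (Eventually.of_forall h0) hF.aestronglyMeasurable, h,
      ENNReal.toReal_ofReal hc]

lemma lintegral_modelDensity {d k : ℕ} (θ : Params d k) :
    ∫⁻ x, ENNReal.ofReal (modelDensity θ x) ∂refMeasure d = ENNReal.ofReal 1 := by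
  refine lintegral_refMeasure_of_fiber (measurable_modelDensity_right θ) fun z => ?_
  have h : ∀ y, modelDensity θ (z, y) = gaussianPDFReal (net θ z) 1 y := fun _ => rfl
  simp only [h, ENNReal.ofReal_one]
  exact lintegral_gaussianPDFReal_eq_one _ one_ne_zero

instance {d k : ℕ} (θ : Params d k) : IsProbabilityMeasure (law (modelDensity θ)) := by
  refine ⟨?_⟩
  rw [law, withDensity_apply _ MeasurableSet.univ, Measure.restrict_univ, lintegral_modelDensity,
    ENNReal.ofReal_one]

lemma measurable_gaussianEnvelope {d k : ℕ} {δ : ℝ} (hδ : δ < 1) (θ : Params d k) :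
    Measurable fun x : (Fin d → ℝ) × ℝ => gaussianEnvelope δ (net θ x.1) x.2 := by
  simp only [gaussianEnvelope_eq hδ]
  have h : Measurable fun x : (Fin d → ℝ) × ℝ => net θ x.1 :=
    (measurable_net_right θ).comp measurable_fst
  exact (((((measurable_snd.sub h).pow_const 2).const_mul _).div_const _).const_sub
    (δ / 2)).exp.const_mul _

/-- If the probability density `f` is at Hellinger distance more than `ε` from `f₀`, then an
envelope `F ≥ f` of nearly the same mass has Hellinger affinity to `f₀` bounded away from one. -/
lemma integral_sqrt_mul_sqrt_le {α : Type*} [MeasurableSpace α] {μ : Measure α}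
    {F f f₀ : α → ℝ} (hFm : Measurable F) (hfm : Measurable f) (hf₀ : Measurable f₀)
    (hf0 : ∀ x, 0 ≤ f x) (hf₀' : ∀ x, 0 ≤ f₀ x) (hfF : ∀ x, f x ≤ F x)
    (iF : Integrable F μ) (if1 : Integrable f μ) (i0 : Integrable f₀ μ)
    (ef : ∫ x, f x ∂μ = 1) (e0 : ∫ x, f₀ x ∂μ = 1) {ε : ℝ} (hε : 0 < ε)
    (eF : ∫ x, F x ∂μ ≤ 1 + ε ^ 4 / 16)
    (hH : ε ^ 2 ≤ ∫ x, (√(f x) - √(f₀ x)) ^ 2 ∂μ) :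
    Integrable (fun x => √(F x) * √(f₀ x)) μ ∧
      ∫ x, √(F x) * √(f₀ x) ∂μ ≤ 1 - ε ^ 2 / 4 := by
  have hF0 : ∀ x, 0 ≤ F x := fun x => (hf0 x).trans (hfF x)
  have iH : Integrable (fun x => (√(f x) - √(f₀ x)) ^ 2) μ := by
    refine (if1.add i0).mono' ((hfm.sqrt.sub hf₀.sqrt).pow_const 2).aestronglyMeasurable
      (Eventually.of_forall fun x => ?_)
    rw [Real.norm_eq_abs, abs_of_nonneg (sq_nonneg _)]
    have h1 := Real.sq_sqrt (hf0 x)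
    have h2 := Real.sq_sqrt (hf₀' x)
    simp only [Pi.add_apply]
    nlinarith [mul_nonneg (Real.sqrt_nonneg (f x)) (Real.sqrt_nonneg (f₀ x))]
  -- The affinity of `F` is that of `f`, at most `1 - ε² / 2`, plus the integral of `(√F - √f) √f₀`.
  -- The latter is bounded by the weighted AM-GM inequality and `(√F - √f)² ≤ F - f`; since the
  -- excess mass is at most `ε⁴ / 16 = κ²`, weight `κ` bounds it by `κ`.
  set κ : ℝ := ε ^ 2 / 4 with hκ
  have hκ0 : 0 < κ := by positivity
  set G : α → ℝ := fun x =>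
    2⁻¹ * (f x + f₀ x - (√(f x) - √(f₀ x)) ^ 2) + 2⁻¹ * (κ * f₀ x + κ⁻¹ * (F x - f x)) with hG
  have i1 : Integrable (fun x => 2⁻¹ * (f x + f₀ x - (√(f x) - √(f₀ x)) ^ 2)) μ :=
    ((if1.add i0).sub iH).const_mul _
  have i2 : Integrable (fun x => 2⁻¹ * (κ * f₀ x + κ⁻¹ * (F x - f x))) μ :=
    ((i0.const_mul κ).add ((iF.sub if1).const_mul _)).const_mul _
  have iG : Integrable G μ := i1.add i2
  have hle : ∀ x, √(F x) * √(f₀ x) ≤ G x := by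
    intro x
    simp only [hG]
    have h1 := Real.sq_sqrt (hf0 x)
    have h2 := Real.sq_sqrt (hf₀' x)
    have h3 := Real.sq_sqrt (hF0 x)
    have h4 := Real.sqrt_le_sqrt (hfF x)
    have h5 := Real.sqrt_nonneg (f x)
    set A := √(F x)
    set B := √(f x)
    set C := √(f₀ x)
    have h6 : (A - B) ^ 2 ≤ F x - f x := by nlinarith
    have h7 : 2 * ((A - B) * C) ≤ κ * C ^ 2 + κ⁻¹ * (A - B) ^ 2 := by
      have : κ * C ^ 2 + κ⁻¹ * (A - B) ^ 2 - 2 * ((A - B) * C) = κ * (C - κ⁻¹ * (A - B)) ^ 2 := by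
        field_simp; ring
      nlinarith [mul_nonneg hκ0.le (sq_nonneg (C - κ⁻¹ * (A - B)))]
    have h8 : κ⁻¹ * (A - B) ^ 2 ≤ κ⁻¹ * (F x - f x) :=
      mul_le_mul_of_nonneg_left h6 (inv_pos.2 hκ0).le
    nlinarith
  have iA : Integrable (fun x => √(F x) * √(f₀ x)) μ := by
    refine iG.mono' (hFm.sqrt.mul hf₀.sqrt).aestronglyMeasurable
      (Eventually.of_forall fun x => ?_)
    rw [Real.norm_eq_abs, abs_of_nonneg (by positivity)]
    exact hle x
  refine ⟨iA, (integral_mono iA iG hle).trans ?_⟩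
  have isum : Integrable (fun x => f x + f₀ x) μ := if1.add i0
  have idiff : Integrable (fun x => κ⁻¹ * (F x - f x)) μ := (iF.sub if1).const_mul _
  have e1 : ∫ x, (f x + f₀ x - (√(f x) - √(f₀ x)) ^ 2) ∂μ =
      1 + 1 - ∫ x, (√(f x) - √(f₀ x)) ^ 2 ∂μ := by
    rw [integral_sub isum iH, integral_add if1 i0, ef, e0]
  have e2 : ∫ x, (κ * f₀ x + κ⁻¹ * (F x - f x)) ∂μ =
      κ * 1 + κ⁻¹ * (∫ x, F x ∂μ - 1) := by
    rw [integral_add (i0.const_mul κ) idiff, integral_const_mul,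
      integral_const_mul, integral_sub iF if1, ef, e0]
  rw [hG, integral_add i1 i2, integral_const_mul, integral_const_mul, e1, e2]
  have h9 : κ⁻¹ * (∫ x, F x ∂μ - 1) ≤ κ := by
    rw [inv_mul_le_iff₀ hκ0, hκ]
    linarith
  linarith

/-- The Hellinger affinity between the truth and the envelope around a network outside the
Hellinger neighbourhood. -/
lemma integral_sqrt_gaussianEnvelope_le {d k : ℕ} {f₀ : (Fin d → ℝ) × ℝ → ℝ}
    (hf₀ : Measurable f₀) (hf₀' : ∀ x, 0 ≤ f₀ x)
    (hf₀1 : ∫⁻ x, ENNReal.ofReal (f₀ x) ∂refMeasure d = 1) {ε δ : ℝ} (hε : 0 < ε) (hδ0 : 0 ≤ δ)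
    (hδ : δ < 1) (hδε : Real.exp (δ / 2) * √((1 - δ)⁻¹) ≤ 1 + ε ^ 4 / 16) {θ : Params d k}
    (hθ : ε < hellinger (modelDensity θ) f₀) :
    Integrable (fun x => √(gaussianEnvelope δ (net θ x.1) x.2) * √(f₀ x)) (refMeasure d) ∧
      ∫ x, √(gaussianEnvelope δ (net θ x.1) x.2) * √(f₀ x) ∂refMeasure d ≤ 1 - ε ^ 2 / 4 := by
  have hFm := measurable_gaussianEnvelope hδ θ
  obtain ⟨iF, eF⟩ := integrable_and_integral_of_lintegral (μ := refMeasure d) hFm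
    (fun x => gaussianEnvelope_nonneg _ _ _) (by positivity)
    (lintegral_refMeasure_of_fiber hFm fun z => lintegral_gaussianEnvelope hδ (net θ z))
  obtain ⟨if1, ef⟩ := integrable_and_integral_of_lintegral (μ := refMeasure d)
    (measurable_modelDensity_right θ) (fun x => (modelDensity_pos θ x).le)
    zero_le_one (lintegral_modelDensity θ)
  obtain ⟨i0, e0⟩ := integrable_and_integral_of_lintegral (μ := refMeasure d) hf₀ hf₀'
    zero_le_one (by rw [hf₀1, ENNReal.ofReal_one])
  exact integral_sqrt_mul_sqrt_le hFm (measurable_modelDensity_right θ) hf₀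
    (fun x => (modelDensity_pos θ x).le) hf₀'
    (fun x => gaussianPDFReal_le_gaussianEnvelope hδ (by simpa using hδ0) _)
    iF if1 i0 ef e0 hε (eF.le.trans hδε) ((Real.lt_sqrt hε.le).1 hθ).le

/-- Under `law f₀` the root of the envelope ratio integrates to at most the affinity, since `√(E /
f₀) f₀ = √E √f₀`. Values of `F` off the cube are irrelevant because `refMeasure` does not charge
them. -/
lemma lintegral_rpow_envelope_le {d k : ℕ} {f₀ : (Fin d → ℝ) × ℝ → ℝ}
    (hf₀ : Measurable f₀) (hf₀' : ∀ x, 0 ≤ f₀ x)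
    (hf₀1 : ∫⁻ x, ENNReal.ofReal (f₀ x) ∂refMeasure d = 1) {ε δ : ℝ} (hε : 0 < ε) (hδ0 : 0 ≤ δ)
    (hδ : δ < 1) (hδε : Real.exp (δ / 2) * √((1 - δ)⁻¹) ≤ 1 + ε ^ 4 / 16) {θ : Params d k}
    (hθ : ε < hellinger (modelDensity θ) f₀) {F : (Fin d → ℝ) × ℝ → ℝ≥0∞} (hFm : Measurable F)
    (hF : ∀ x, x.1 ∈ Icc (0 : Fin d → ℝ) 1 →
      F x = ENNReal.ofReal (gaussianEnvelope δ (net θ x.1) x.2 / f₀ x)) :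
    ∫⁻ x, F x ^ (2⁻¹ : ℝ) ∂law f₀ ≤ ENNReal.ofReal (Real.exp (-(ε ^ 2 / 4))) := by
  obtain ⟨iA, hA⟩ := integral_sqrt_gaussianEnvelope_le hf₀ hf₀' hf₀1 hε hδ0 hδ hδε hθ
  have hcube : ∀ᵐ x ∂refMeasure d, x.1 ∈ Icc (0 : Fin d → ℝ) 1 := by
    have h : ∀ᵐ z ∂cubeUniform d, z ∈ Icc (0 : Fin d → ℝ) 1 :=
      ae_restrict_mem measurableSet_Icc
    exact Measure.quasiMeasurePreserving_fst.ae h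
  rw [law, lintegral_withDensity_eq_lintegral_mul _ hf₀.ennreal_ofReal (hFm.pow_const _)]
  calc _ ≤ ∫⁻ x, ENNReal.ofReal (√(gaussianEnvelope δ (net θ x.1) x.2) * √(f₀ x))
        ∂refMeasure d := by
        refine lintegral_mono_ae ?_
        filter_upwards [hcube] with x hx
        rw [Pi.mul_apply, hF x hx]
        set E := gaussianEnvelope δ (net θ x.1) x.2 with hE
        have hE0 : 0 ≤ E := gaussianEnvelope_nonneg _ _ _
        have h1 : 0 ≤ E / f₀ x := div_nonneg hE0 (hf₀' x)
        rw [ENNReal.ofReal_rpow_of_nonneg h1 (by norm_num), ← ENNReal.ofReal_mul (hf₀' x)]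
        refine ENNReal.ofReal_le_ofReal ?_
        have : (E / f₀ x) ^ (2⁻¹ : ℝ) = √E / √(f₀ x) := by
          rw [← Real.sqrt_div hE0, Real.sqrt_eq_rpow]; norm_num
        rw [this]
        rcases (hf₀' x).eq_or_lt with h0 | h0
        · simp [← h0]
        · have h2 := Real.sq_sqrt (hf₀' x)
          have h3 := Real.sqrt_pos.2 h0
          refine le_of_eq ?_
          field_simp
          rw [h2, mul_comm]
    _ = ENNReal.ofReal (∫ x, √(gaussianEnvelope δ (net θ x.1) x.2) * √(f₀ x) ∂refMeasure d) :=
        (ofReal_integral_eq_lintegral_ofReal iA (Eventually.of_forall fun x => by positivity)).symm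
    _ ≤ _ := by
        refine ENNReal.ofReal_le_ofReal (hA.trans ?_)
        linarith [Real.add_one_le_exp (-(ε ^ 2 / 4))]

/-- The mass of the envelope is continuous in `δ` and equals one at `δ = 0`. -/
lemma exists_envelope_radius {ε : ℝ} (hε : 0 < ε) : ∃ δ : ℝ, 0 < δ ∧ δ < 1 ∧
    Real.exp (δ / 2) * √((1 - δ)⁻¹) ≤ 1 + ε ^ 4 / 16 := by
  have hc : ContinuousAt (fun δ : ℝ => Real.exp (δ / 2) * √((1 - δ)⁻¹)) 0 := by
    refine ContinuousAt.mul (by fun_prop) (ContinuousAt.sqrt ?_)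
    exact ContinuousAt.inv₀ (by fun_prop) (by norm_num)
  have h1 : ∀ᶠ δ : ℝ in 𝓝 0, Real.exp (δ / 2) * √((1 - δ)⁻¹) < 1 + ε ^ 4 / 16 := by
    refine hc.eventually (gt_mem_nhds ?_)
    have : 0 < ε ^ 4 / 16 := by positivity
    simpa using by linarith
  have h2 : ∀ᶠ δ : ℝ in 𝓝 0, δ < 1 := gt_mem_nhds one_pos
  obtain ⟨δ, ⟨h3, h4⟩, h5⟩ :=
    (((h1.and h2).filter_mono nhdsWithin_le_nhds).and (self_mem_nhdsWithin (s := Ioi 0))).exists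
  exact ⟨δ, h5, h4, h3.le⟩

/-- Kullback-Leibler neighbourhoods in terms of the log-likelihood ratio. -/
lemma integrable_log_of_mem_klNhd {d k : ℕ} {f₀ : (Fin d → ℝ) × ℝ → ℝ} (hf₀ : Measurable f₀)
    (hf₀' : ∀ x, 0 ≤ f₀ x) [IsProbabilityMeasure (law f₀)] {γ : ℝ} (hγ : 0 ≤ γ)
    {θ : Params d k} (hθ : θ ∈ klNhd k f₀ γ) :
    Integrable (fun x => Real.log (modelDensity θ x / f₀ x)) (law f₀) ∧
      -γ ≤ ∫ x, Real.log (modelDensity θ x / f₀ x) ∂law f₀ := by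
  have hθ' : InformationTheory.klDiv (law f₀) (law (modelDensity θ)) ≤ ENNReal.ofReal γ := hθ
  have hne := ne_top_of_le_ne_top ENNReal.ofReal_ne_top hθ'
  obtain ⟨hac, hint⟩ := InformationTheory.klDiv_ne_top_iff.1 hne
  have hfm := measurable_modelDensity_right θ
  have hdiv : Measurable fun x => ENNReal.ofReal (f₀ x / modelDensity θ x) :=
    (hf₀.div hfm).ennreal_ofReal
  have hlaw : law f₀ = (law (modelDensity θ)).withDensity
      fun x => ENNReal.ofReal (f₀ x / modelDensity θ x) := by
    unfold law
    rw [← withDensity_mul _ hfm.ennreal_ofReal hdiv]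
    congr 1
    funext x
    rw [Pi.mul_apply, ← ENNReal.ofReal_mul (modelDensity_pos θ x).le,
      mul_div_cancel₀ _ (modelDensity_pos θ x).ne']
  have hrn : (law f₀).rnDeriv (law (modelDensity θ)) =ᵐ[law f₀]
      fun x => ENNReal.ofReal (f₀ x / modelDensity θ x) := by
    refine hac.ae_le ?_
    have := Measure.rnDeriv_withDensity (law (modelDensity θ)) hdiv
    rwa [← hlaw] at this
  have hllr : llr (law f₀) (law (modelDensity θ)) =ᵐ[law f₀]
      fun x => -Real.log (modelDensity θ x / f₀ x) := by
    filter_upwards [hrn] with x hx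
    rw [llr, hx, ENNReal.toReal_ofReal (div_nonneg (hf₀' x) (modelDensity_pos θ x).le),
      ← Real.log_inv, inv_div]
  have hint' := hint.congr hllr
  refine ⟨by simpa using hint'.neg, ?_⟩
  -- Both laws have mass one, so the divergence has no mass correction and is the integral of the
  -- log-likelihood ratio.
  have h1 := InformationTheory.toReal_klDiv_of_measure_eq hac (by simp)
  rw [integral_congr_ae hllr, integral_neg] at h1
  have h2 := ENNReal.toReal_le_of_le_ofReal hγ hθ'
  linarith

end BNN

/-! ### Envelopes for the network model and the posterior distribution -/

namespace BNN

/-- The likelihood ratio of a network with respect to the true density. -/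
noncomputable def ratio {d : ℕ} (f₀ : (Fin d → ℝ) × ℝ → ℝ) (θ : FullParams d) (x : (Fin d → ℝ) × ℝ) : ℝ :=
  modelDensity θ.2 x / f₀ x

lemma measurable_ratio {d : ℕ} {f₀ : (Fin d → ℝ) × ℝ → ℝ} (hf₀ : Measurable f₀) :
    Measurable (Function.uncurry (ratio f₀)) :=
  (measurable_modelDensity d).div (hf₀.comp measurable_snd)

lemma ae_law_pos {d : ℕ} {f₀ : (Fin d → ℝ) × ℝ → ℝ} (hf₀ : Measurable f₀) :
    ∀ᵐ x ∂law f₀, 0 < f₀ x := by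
  rw [law, ae_withDensity_iff hf₀.ennreal_ofReal]
  refine Eventually.of_forall fun x hx => ?_
  by_contra hcon
  exact hx (ENNReal.ofReal_of_nonpos (not_lt.1 hcon))

/-- Only an inequality: the mass of the model density where `f₀` vanishes is lost. -/
lemma lintegral_ratio_le_one {d : ℕ} {f₀ : (Fin d → ℝ) × ℝ → ℝ} (hf₀ : Measurable f₀)
    (hf₀' : ∀ x, 0 ≤ f₀ x) (θ : FullParams d) :
    ∫⁻ x, ENNReal.ofReal (ratio f₀ θ x) ∂law f₀ ≤ 1 := by
  have hm : Measurable fun x => ENNReal.ofReal (ratio f₀ θ x) :=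
    ((measurable_modelDensity_right θ.2).div hf₀).ennreal_ofReal
  rw [law, lintegral_withDensity_eq_lintegral_mul _ hf₀.ennreal_ofReal hm]
  calc _ ≤ ∫⁻ x, ENNReal.ofReal (modelDensity θ.2 x) ∂refMeasure d := by
        refine lintegral_mono fun x => ?_
        rw [Pi.mul_apply, ← ENNReal.ofReal_mul (hf₀' x), ratio]
        refine ENNReal.ofReal_le_ofReal ?_
        rcases (hf₀' x).eq_or_lt with h0 | h0
        · rw [← h0, zero_mul]
          exact (modelDensity_pos _ _).le
        · rw [mul_div_cancel₀ _ h0.ne']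
    _ = 1 := by rw [lintegral_modelDensity, ENNReal.ofReal_one]

/-- The networks of the sieve outside the Hellinger neighbourhood are covered by subexponentially
many envelopes whose Hellinger affinity to the truth is bounded away from one. -/
lemma eventually_exists_envelopes {d : ℕ} {f₀ : (Fin d → ℝ) × ℝ → ℝ} (hf₀ : Measurable f₀)
    (hf₀' : ∀ x, 0 ≤ f₀ x) (hf₀1 : ∫⁻ x, ENNReal.ofReal (f₀ x) ∂refMeasure d = 1)
    {R ε : ℝ} (hR : 0 ≤ R) (hε : 0 < ε) :
    ∀ᶠ n : ℕ in atTop, ∃ (N : ℕ) (F : Fin N → (Fin d → ℝ) × ℝ → ℝ≥0∞),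
      (N : ℝ) ≤ Real.exp (n * (ε ^ 2 / 4 / 4)) ∧ (∀ c, Measurable (F c)) ∧
      (∀ θ ∈ energySieve d R n ∩ (hellingerNhd f₀ ε)ᶜ, ∃ c, ∀ x,
        ENNReal.ofReal (ratio f₀ θ x) ≤ F c x) ∧
      ∀ c, ∫⁻ x, F c x ^ (2⁻¹ : ℝ) ∂law f₀ ≤ ENNReal.ofReal (Real.exp (-(ε ^ 2 / 4))) := by
  classical
  obtain ⟨δ, hδ0, hδ1, hδ⟩ := exists_envelope_radius hε
  filter_upwards [eventually_exists_unifCover_energyNets d hR (half_pos hδ0)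
    (show 0 < ε ^ 2 / 4 / 4 by positivity)] with n ⟨N, hN, s, hs⟩
  set V : Set (FullParams d) := energySieve d R n ∩ (hellingerNhd f₀ ε)ᶜ with hV
  set near : Fin N → FullParams d → Prop := fun c θ =>
    ∀ z ∈ Icc (0 : Fin d → ℝ) 1, |net θ.2 z - s c z| ≤ δ / 2 with hnear
  -- Each ball is recentred at one of its networks in `V`, which is measurable and outside
  -- `hellingerNhd`, unlike possibly `s c`; hence the cover at radius `δ / 2`. The value `⊤` off the
  -- cube, where the cover controls nothing, is harmless for `law f₀`.
  set F : Fin N → (Fin d → ℝ) × ℝ → ℝ≥0∞ := fun c x =>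
    if h : ∃ θ ∈ V, near c θ then
      if x.1 ∈ Icc (0 : Fin d → ℝ) 1 then
        ENNReal.ofReal (gaussianEnvelope δ (net h.choose.2 x.1) x.2 / f₀ x)
      else ⊤
    else 0 with hF
  have hFm : ∀ c, Measurable (F c) := by
    intro c
    by_cases h : ∃ θ ∈ V, near c θ
    · simp only [hF, dif_pos h]
      exact Measurable.ite (measurable_fst measurableSet_Icc)
        ((measurable_gaussianEnvelope hδ1 _).div hf₀).ennreal_ofReal measurable_const
    · simp only [hF, dif_neg h]
      exact measurable_const
  refine ⟨N, F, hN, hFm, ?_, ?_⟩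
  · intro θ hθ
    obtain ⟨c, hc⟩ := hs (net θ.2) ⟨θ.1, hθ.1.1, θ.2, hθ.1.2, rfl⟩
    have h : ∃ θ ∈ V, near c θ := ⟨θ, hθ, hc⟩
    refine ⟨c, fun x => ?_⟩
    simp only [hF, dif_pos h]
    split_ifs with hx
    · refine ENNReal.ofReal_le_ofReal (div_le_div_of_nonneg_right ?_ (hf₀' x))
      refine gaussianPDFReal_le_gaussianEnvelope hδ1 ?_ _
      have h1 := hc x.1 hx
      have h2 := h.choose_spec.2 x.1 hx
      rw [abs_sub_comm] at h2
      have h3 := abs_sub_le (net θ.2 x.1) (s c x.1) (net h.choose.2 x.1)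
      linarith
    · exact le_top
  · intro c
    by_cases h : ∃ θ ∈ V, near c θ
    · have hlt : ε < hellinger (modelDensity h.choose.2) f₀ := not_le.1 h.choose_spec.1.2
      refine lintegral_rpow_envelope_le hf₀ hf₀' hf₀1 hε hδ0.le hδ1 hδ hlt (hFm c) fun x hx => ?_
      simp only [hF, dif_pos h, if_pos hx]
    · simp only [hF, dif_neg h]
      simp

lemma measurable_modelDensity_left {d : ℕ} (x : (Fin d → ℝ) × ℝ) :
    Measurable fun θ : FullParams d => modelDensity θ.2 x := by
  refine measurable_sigma fun k => ?_
  unfold modelDensity gaussianPDFReal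
  have h : Measurable fun θ : Params d k => net θ x.1 :=
    (measurable_net d k).comp (measurable_id.prodMk measurable_const)
  exact ((((h.const_sub x.2).pow_const 2).neg.div_const _).exp).const_mul _

lemma measurable_likelihood {d n : ℕ} (x : Fin n → (Fin d → ℝ) × ℝ) :
    Measurable fun θ : FullParams d => likelihood x θ :=
  Finset.measurable_prod _ fun i _ => (measurable_modelDensity_left (x i)).ennreal_ofReal

lemma lintegral_likelihood_ne_zero {d n : ℕ} (p : unitInterval) (τ : ℝ≥0)
    (x : Fin n → (Fin d → ℝ) × ℝ) : ∫⁻ θ, likelihood x θ ∂prior d p τ ≠ 0 := by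
  rw [Ne, lintegral_eq_zero_iff (measurable_likelihood x)]
  intro h
  obtain ⟨θ, hθ⟩ := h.exists
  have : likelihood x θ ≠ 0 := Finset.prod_ne_zero_iff.2 fun i _ => by
    simpa using modelDensity_pos θ.2 (x i)
  exact this hθ

lemma lintegral_likelihood_ne_top {d n : ℕ} (p : unitInterval) (τ : ℝ≥0)
    (x : Fin n → (Fin d → ℝ) × ℝ) : ∫⁻ θ, likelihood x θ ∂prior d p τ ≠ ∞ := by
  have hle : ∀ θ : FullParams d, likelihood x θ ≤
      ∏ _i : Fin n, ENNReal.ofReal ((√(2 * Real.pi))⁻¹) := by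
    intro θ
    refine Finset.prod_le_prod' fun i _ => ENNReal.ofReal_le_ofReal ?_
    rw [modelDensity, gaussianPDFReal, NNReal.coe_one, mul_one]
    refine mul_le_of_le_one_right (by positivity) (Real.exp_le_one_iff.2 ?_)
    exact div_nonpos_of_nonpos_of_nonneg (neg_nonpos.2 (sq_nonneg _)) (by norm_num)
  refine ne_top_of_le_ne_top ?_ (lintegral_mono hle)
  rw [lintegral_const, measure_univ, mul_one]
  exact ENNReal.prod_ne_top fun i _ => ENNReal.ofReal_ne_top

lemma posterior_apply {d n : ℕ} (p : unitInterval) (τ : ℝ≥0) (x : Fin n → (Fin d → ℝ) × ℝ)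
    {A : Set (FullParams d)} (hA : MeasurableSet A) :
    posterior p τ x A =
      (∫⁻ θ, likelihood x θ ∂prior d p τ)⁻¹ * ∫⁻ θ in A, likelihood x θ ∂prior d p τ := by
  rw [posterior, Measure.smul_apply, withDensity_apply _ hA, smul_eq_mul]

instance {d n : ℕ} (p : unitInterval) (τ : ℝ≥0) (x : Fin n → (Fin d → ℝ) × ℝ) :
    IsProbabilityMeasure (posterior p τ x) := by
  refine ⟨?_⟩
  rw [posterior_apply p τ x MeasurableSet.univ, Measure.restrict_univ]
  exact ENNReal.inv_mul_cancel (lintegral_likelihood_ne_zero p τ x)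
    (lintegral_likelihood_ne_top p τ x)

/-- Convergence in measure is phrased with `edist`; this turns it into a statement on the posterior
mass of the complement. -/
lemma edist_posterior_real_one {d n : ℕ} (p : unitInterval) (τ : ℝ≥0)
    (x : Fin n → (Fin d → ℝ) × ℝ) {A : Set (FullParams d)} (hA : MeasurableSet A) :
    edist ((posterior p τ x).real A) 1 = posterior p τ x Aᶜ := by
  have h := probReal_compl_eq_one_sub (μ := posterior p τ x) hA
  rw [edist_comm, edist_dist, Real.dist_eq, ← h, abs_of_nonneg measureReal_nonneg,
    ofReal_measureReal]

/-- The factor `∏ f₀` does not depend on `θ`, so it cancels in the posterior. -/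
lemma likelihood_eq_mul_lr {d n : ℕ} {Ω : Type*} {f₀ : (Fin d → ℝ) × ℝ → ℝ}
    {X : ℕ → Ω → (Fin d → ℝ) × ℝ} {ω : Ω} (h : ∀ i, 0 < f₀ (X i ω)) (θ : FullParams d) :
    likelihood (fun i : Fin n => X i ω) θ =
      (∏ i ∈ Finset.range n, ENNReal.ofReal (f₀ (X i ω))) *
        PosteriorConsistency.lr (ratio f₀) X n θ ω := by
  rw [likelihood, PosteriorConsistency.lr, ← Finset.prod_mul_distrib,
    Finset.prod_range fun i => ENNReal.ofReal (f₀ (X i ω)) * ENNReal.ofReal (ratio f₀ θ (X i ω))]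
  refine Finset.prod_congr rfl fun i _ => ?_
  rw [← ENNReal.ofReal_mul (h _).le, ratio, mul_div_cancel₀ _ (h _).ne']

end BNN

/-! ### Consistency of the posterior -/

theorem theorem2
    -- the model: `d` inputs, geometric(`p`) number of hidden nodes, `N(0, τ²)` parameters
    (d : ℕ) (p : unitInterval) (hp : 0 < p) (τ : ℝ≥0) (hτ : 0 < τ)
    -- the true density, under which the inputs are uniform on the cube
    (f₀ : (Fin d → ℝ) × ℝ → ℝ) (hf₀_meas : Measurable f₀) (hf₀_nonneg : ∀ x, 0 ≤ f₀ x)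
    (hf₀_unif : (BNN.law f₀).map Prod.fst = BNN.cubeUniform d)
    -- the i.i.d. observations
    {Ω : Type*} [MeasurableSpace Ω] (P : Measure Ω) [IsProbabilityMeasure P]
    (Z : ℕ → Ω → (Fin d → ℝ)) (Y : ℕ → Ω → ℝ)
    (hZ_meas : ∀ i, Measurable (Z i)) (hY_meas : ∀ i, Measurable (Y i))
    (h_indep : iIndepFun (fun i ω => (Z i ω, Y i ω)) P)
    (h_law : ∀ i, P.map (fun ω => (Z i ω, Y i ω)) = BNN.law f₀)
    -- the constants of the sieve
    (a b : ℝ) (ha : 0 < a) (hab : a < b) (hb : b < 1)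
    (C : ℕ → ℝ) (hC_mono : Monotone C) (hC_le : ∀ n : ℕ, C n ≤ Real.exp ((n : ℝ) ^ (b - a)))
    (B : ℕ → ℕ) (hB_mono : Monotone B)
    -- (A1)
    (hA1 : ∀ i, 0 < BNN.nodeProb p i)
    -- (A2)
    (hA2 : ∀ r : ℝ, 0 < r → ∃ q : ℝ, 1 < q ∧ ∃ N : ℕ, ∀ n ≥ N,
      ∑' j : ℕ, BNN.nodeProb p (B n + 1 + j) < Real.exp (-((n : ℝ) ^ q * r)))
    -- (A3)
    (hA3 : ∀ i : ℕ, ∃ r : ℝ, 0 < r ∧ ∃ N : ℕ, ∀ n ≥ N,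
      (BNN.paramPrior d i τ).real (BNN.sieve d i a C n)ᶜ < Real.exp (-(n * r)))
    -- (A4)
    (hA4 : ∀ γ v : ℝ, 0 < γ → 0 < v → ∃ I : ℕ, ∀ i ≥ I, ∃ M : ℕ, ∀ n ≥ M,
      Real.exp (-(n * v)) ≤ (BNN.paramPrior d i τ).real (BNN.klNhd i f₀ γ)) :
    ∀ ε : ℝ, 0 < ε →
      TendstoInMeasure P
        (fun (n : ℕ) (ω : Ω) =>
          (BNN.posterior p τ (fun i : Fin n => (Z i ω, Y i ω))).real (BNN.hellingerNhd f₀ ε))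
        atTop (fun _ => 1) := by
  intro ε hε
  set X : ℕ → Ω → (Fin d → ℝ) × ℝ := fun i ω => (Z i ω, Y i ω) with hXdef
  have hX : ∀ i, Measurable (X i) := fun i => (hZ_meas i).prodMk (hY_meas i)
  have hlaw : ∀ i, P.map (X i) = BNN.law f₀ := h_law
  have : IsProbabilityMeasure (BNN.law f₀) := by
    rw [← hlaw 0]
    exact Measure.isProbabilityMeasure_map (hX 0).aemeasurable
  have hf₀1 : ∫⁻ x, ENNReal.ofReal (f₀ x) ∂BNN.refMeasure d = 1 := by
    have := measure_univ (μ := BNN.law f₀)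
    rwa [BNN.law, withDensity_apply _ MeasurableSet.univ, Measure.restrict_univ] at this
  -- For `p = 1` the prior would give no mass to one hidden node, against (A1).
  have hp1 : p < 1 := by
    refine lt_of_le_of_ne unitInterval.le_one' fun h => ?_
    have := hA1 1
    rw [BNN.nodeProb, geometricMeasure_real_singleton hp.ne', h] at this
    simp at this
  obtain ⟨R, c, hR, hc, hSc⟩ := BNN.exists_prior_compl_energySieve_le d hp hp1 τ
  have hpos := BNN.ae_law_pos hf₀_meas
  have hKL : ∀ γ : ℝ, 0 < γ → 0 < BNN.prior d p τ {θ |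
      Integrable (fun x => Real.log (BNN.ratio f₀ θ x)) (BNN.law f₀) ∧
      -γ < ∫ x, Real.log (BNN.ratio f₀ θ x) ∂BNN.law f₀} := by
    intro γ hγ
    -- Only positivity of the prior mass is needed, so any rate and a single `n` will do; the radius
    -- `γ / 2` yields the strict inequality.
    obtain ⟨I, hI⟩ := hA4 (γ / 2) 1 (half_pos hγ) one_pos
    obtain ⟨M, hM⟩ := hI I le_rfl
    have h1 : 0 < (BNN.paramPrior d I τ) (BNN.klNhd I f₀ (γ / 2)) :=
      (ENNReal.toReal_pos_iff.1 ((Real.exp_pos _).trans_le (hM M le_rfl))).1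
    refine lt_of_lt_of_le ?_ (BNN.mul_paramPrior_le_prior d I p τ _)
    refine ENNReal.mul_pos (ENNReal.ofReal_pos.2 (hA1 I)).ne' (h1.trans_le (measure_mono ?_)).ne'
    intro θ hθ
    obtain ⟨h2, h3⟩ := BNN.integrable_log_of_mem_klNhd hf₀_meas hf₀_nonneg (half_pos hγ).le hθ
    refine ⟨h2, lt_of_lt_of_le ?_ h3⟩
    linarith
  have hH := BNN.measurableSet_hellingerNhd hf₀_meas ε
  intro δ hδ
  have key := PosteriorConsistency.tendsto_measure_posterior_ge hX h_indep hlaw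
    (BNN.measurable_ratio hf₀_meas)
    (fun θ => by
      filter_upwards [hpos] with x hx
      exact div_pos (BNN.modelDensity_pos _ _) hx)
    (BNN.lintegral_ratio_le_one hf₀_meas hf₀_nonneg) (BNN.prior d p τ) hKL hH.compl
    (BNN.energySieve d R) (BNN.measurableSet_energySieve d R) hc
    (show 0 < ε ^ 2 / 4 by positivity) hSc
    (BNN.eventually_exists_envelopes hf₀_meas hf₀_nonneg hf₀1 hR hε) hδ
  have hae : ∀ᵐ ω ∂P, ∀ i, 0 < f₀ (X i ω) := ae_all_iff.2 fun i =>
    (⟨hX i, hlaw i⟩ : MeasurePreserving (X i) P (BNN.law f₀)).quasiMeasurePreserving.ae hpos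
  refine tendsto_of_tendsto_of_tendsto_of_le_of_le tendsto_const_nhds key
    (fun _ => zero_le) fun n => measure_mono_ae ?_
  filter_upwards [hae] with ω hω h
  change δ ≤ edist ((BNN.posterior p τ fun i : Fin n => X i ω).real (BNN.hellingerNhd f₀ ε)) 1 at h
  change δ * _ ≤ _
  rw [BNN.edist_posterior_real_one p τ _ hH, BNN.posterior_apply p τ _ hH.compl] at h
  set q := ∏ i ∈ Finset.range n, ENNReal.ofReal (f₀ (X i ω)) with hq
  have hq0 : q ≠ 0 := Finset.prod_ne_zero_iff.2 fun i _ => by simpa using hω i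
  have hq1 : q ≠ ∞ := ENNReal.prod_ne_top fun i _ => ENNReal.ofReal_ne_top
  have hD0 := BNN.lintegral_likelihood_ne_zero p τ fun i : Fin n => X i ω
  have hD1 := BNN.lintegral_likelihood_ne_top p τ fun i : Fin n => X i ω
  have h2 : δ * ∫⁻ θ, BNN.likelihood (fun i : Fin n => X i ω) θ ∂BNN.prior d p τ ≤
      ∫⁻ θ in (BNN.hellingerNhd f₀ ε)ᶜ, BNN.likelihood (fun i : Fin n => X i ω) θ
        ∂BNN.prior d p τ := by
    rw [mul_comm, ← div_eq_mul_inv] at h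
    exact (ENNReal.le_div_iff_mul_le (Or.inl hD0) (Or.inl hD1)).1 h
  simp only [BNN.likelihood_eq_mul_lr hω] at h2
  rw [lintegral_const_mul' _ _ hq1, lintegral_const_mul' _ _ hq1, mul_left_comm,
    ENNReal.mul_le_mul_iff_right hq0 hq1] at h2
  exact h2
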